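/- Let $V$ be a vector space over a field $\mathbf{k}$. A \emph{cyclic algebra structure} on $V$ consists of a symmetric nondegenerate bilinear form $b\colon V\otimes V\to\mathbf{k}$ (nondegenerate in the sense that $x\mapsto b(x,-)$ is an isomorphism $V\to V^\vee$, so that $V$ is finite dimensional) and a sequence $(T_r)_{r\in\mathbb{N}}$ of linear maps $T_r\colon V^{\otimes r}\to\mathbf{k}$ that are cyclically invariant: $$T_r(X_1\otimes\dots\otimes X_{r-1}\otimes X_r)=T_r(X_r\otimes X_1\otimes\dots\otimes X_{r-1}).$$ A \emph{ribbon graph of type $(p,q)$} is a finite graph (vertices of any valence $\ge 0$, loops, multiple edges and closed circles without vertices allowed) with $p$ numbered incoming and $q$ numbered outgoing endpoints and with a cyclic order on the half-edges stemming from each vertex; ribbon graphs are taken up to isomorphism. The linear spans $\mathrm{RG}(p,q)$ of the ribbon graphs of type $(p,q)$ are the $\mathrm{Hom}$-spaces of a symmetric linear PROP $\mathrm{RG}$: composition is the bilinear extension of gluing outgoing endpoints to incoming endpoints, the tensor product is juxtaposition, the identities are parallel strands and the symmetry is the crossing of strands. An \emph{$\mathrm{RG}$-algebra structure} on $V$ is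 a morphism of symmetric linear PROPs $Z\colon \mathrm{RG}\to\mathrm{End}_V$, that is, a family of linear maps $Z\colon\mathrm{RG}(p,q)\to\mathrm{Hom}(V^{\otimes p},V^{\otimes q})$ that preserves identities, composition, tensor products and the symmetry (the symmetry of $\mathrm{End}_V$ being $x\otimes y\mapsto y\otimes x$). Theorem. Cyclic algebra structures on $V$ and $\mathrm{RG}$-algebra structures on $V$ are equivalent data. Explicitly, sending an $\mathrm{RG}$-algebra structure $Z$ to the pair $(b,(T_r)_{r\in\mathbb{N}})$, where $b=Z(\text{a single arc joining two incoming endpoints})$ and $T_r=Z(\text{a single $r$-valent vertex whose half-edges are joined, in cyclic order, to the incoming endpoints }1,\dots,r)$, is a bijection from the set of $\mathrm{RG}$-algebra structures on $V$ onto the set of cyclic algebra structures on $V$. -/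

import Mathlib

open scoped TensorProduct

universe u v

/-! ## Ribbon graphs -/

/-- A ribbon graph of type `(p, q)`: a finite one-dimensional complex with `p` numbered incoming and
`q` numbered outgoing endpoints, and a cyclic order on the half-edges at each vertex.

Each edge is either an arc, which has exactly two ends, or a closed circle that meets no vertex
(such circles arise when graphs are composed), which has none. An end of an arc is a half-edge at a
vertex, an incoming endpoint, or an outgoing endpoint. -/
structure RibbonGraph (p q : ℕ) : Type 1 where
  /-- the vertices (endpoints are not vertices) -/
  Vert : Type
  /-- the half-edges at the vertices -/
  Half : Type
  /-- the edges -/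
  Edge : Type
  finite_vert : Finite Vert
  finite_half : Finite Half
  finite_edge : Finite Edge
  /-- the vertex from which a half-edge stems -/
  vert : Half → Vert
  /-- the successor of a half-edge in the cyclic order at its vertex -/
  next : Equiv.Perm Half
  /-- the half-edges at a given vertex form one cycle of `next` -/
  sameCycle_iff : ∀ h h', next.SameCycle h h' ↔ vert h = vert h'
  /-- the edge to which an end belongs -/
  edge : Half ⊕ (Fin p ⊕ Fin q) → Edge
  /-- an edge that has an end has exactly two ends -/
  other_end : ∀ x, ∃! y, y ≠ x ∧ edge y = edge x

namespace RibbonGraph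

/-- An isomorphism of ribbon graphs: it respects incidence and the cyclic orders, and fixes the
numbering of the endpoints. -/
structure Iso {p q : ℕ} (G G' : RibbonGraph p q) where
  onVert : G.Vert ≃ G'.Vert
  onHalf : G.Half ≃ G'.Half
  onEdge : G.Edge ≃ G'.Edge
  vert_eq : ∀ h, G'.vert (onHalf h) = onVert (G.vert h)
  next_eq : ∀ h, G'.next (onHalf h) = onHalf (G.next h)
  edge_eq : ∀ x, G'.edge (Sum.map onHalf id x) = onEdge (G.edge x)

namespace Iso

variable {p q : ℕ} {G G' G'' : RibbonGraph p q}

/-- The identity isomorphism. -/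
def refl (G : RibbonGraph p q) : Iso G G where
  onVert := Equiv.refl _
  onHalf := Equiv.refl _
  onEdge := Equiv.refl _
  vert_eq _ := rfl
  next_eq _ := rfl
  edge_eq x := by rcases x with x | x <;> rfl

/-- The inverse isomorphism. -/
def symm (e : Iso G G') : Iso G' G where
  onVert := e.onVert.symm
  onHalf := e.onHalf.symm
  onEdge := e.onEdge.symm
  vert_eq h := by
    rw [Equiv.eq_symm_apply, ← e.vert_eq, Equiv.apply_symm_apply]
  next_eq h := by
    rw [Equiv.eq_symm_apply, ← e.next_eq, Equiv.apply_symm_apply]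
  edge_eq x := by
    rw [Equiv.eq_symm_apply, ← e.edge_eq]
    rcases x with x | x <;> simp

/-- Composition of isomorphisms. -/
def trans (e : Iso G G') (e' : Iso G' G'') : Iso G G'' where
  onVert := e.onVert.trans e'.onVert
  onHalf := e.onHalf.trans e'.onHalf
  onEdge := e.onEdge.trans e'.onEdge
  vert_eq h := by simp [e.vert_eq, e'.vert_eq]
  next_eq h := by simp [e.next_eq, e'.next_eq]
  edge_eq x := by
    have h1 := e.edge_eq x
    have h2 := e'.edge_eq (Sum.map e.onHalf id x)
    rw [Sum.map_map] at h2
    simp only [Equiv.trans_apply, ← h1, ← h2]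
    rfl

end Iso

/-- Ribbon graphs are considered up to isomorphism. -/
instance isoSetoid (p q : ℕ) : Setoid (RibbonGraph p q) where
  r G G' := Nonempty (Iso G G')
  iseqv :=
    { refl := fun G => ⟨Iso.refl G⟩
      symm := fun ⟨e⟩ => ⟨e.symm⟩
      trans := fun ⟨e⟩ ⟨e'⟩ => ⟨e.trans e'⟩ }

/-! ### Elementary graphs -/

/-- The ribbon graph without vertices given by a pairing of its endpoints. -/
def wiring {p q : ℕ} (E : Type) (hE : Finite E) (f : Fin p ⊕ Fin q → E)
    (hf : ∀ x, ∃! y, y ≠ x ∧ f y = f x) : RibbonGraph p q where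
  Vert := Empty
  Half := Empty
  Edge := E
  finite_vert := inferInstance
  finite_half := inferInstance
  finite_edge := hE
  vert := id
  next := Equiv.refl _
  sameCycle_iff h := h.elim
  edge := Sum.elim Empty.elim f
  other_end := by
    rintro (x | x)
    · exact x.elim
    · obtain ⟨y, hy, hu⟩ := hf x
      refine ⟨Sum.inr y, ⟨fun h => hy.1 (Sum.inr_injective h), hy.2⟩, ?_⟩
      rintro (z | z) hz
      · exact z.elim
      · rw [hu z ⟨fun h => hz.1 (congrArg _ h), hz.2⟩]

theorem existsUnique_other_of_equiv {α β γ : Type} (f : α ≃ γ) (g : β ≃ γ) (x : α ⊕ β) :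
    ∃! y, y ≠ x ∧ Sum.elim f g y = Sum.elim f g x := by
  rcases x with x | x
  · refine ⟨Sum.inr (g.symm (f x)), by simp, ?_⟩
    rintro (y | y) ⟨h1, h2⟩
    · exact absurd (congrArg Sum.inl (f.injective h2)) h1
    · simp only [Sum.elim_inl, Sum.elim_inr] at h2
      rw [← h2, Equiv.symm_apply_apply]
  · refine ⟨Sum.inl (f.symm (g x)), by simp, ?_⟩
    rintro (y | y) ⟨h1, h2⟩
    · simp only [Sum.elim_inl, Sum.elim_inr] at h2
      rw [← h2, Equiv.symm_apply_apply]
    · exact absurd (congrArg Sum.inr (g.injective h2)) h1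

/-- The identity graph: `n` parallel strands. -/
def strands (n : ℕ) : RibbonGraph n n :=
  wiring (Fin n) inferInstance (Sum.elim (Equiv.refl _) (Equiv.refl _))
    (existsUnique_other_of_equiv _ _)

/-- The crossing of `m` parallel strands with `n` parallel strands. -/
def crossing (m n : ℕ) : RibbonGraph (m + n) (n + m) :=
  wiring (Fin m ⊕ Fin n) inferInstance
    (Sum.elim finSumFinEquiv.symm (finSumFinEquiv.symm.trans (Equiv.sumComm _ _)))
    (existsUnique_other_of_equiv _ _)

/-- A single arc that joins two incoming endpoints. -/
def arc : RibbonGraph 2 0 :=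
  wiring Unit inferInstance (fun _ => ()) (by
    rintro (x | x)
    · refine ⟨Sum.inl (1 - x), ⟨?_, rfl⟩, ?_⟩
      · fin_cases x <;> simp
      · rintro (y | y) hy
        · fin_cases x <;> fin_cases y <;> simp_all
        · exact y.elim0
    · exact x.elim0)

/-- The graph with a single vertex of valence `r`, whose half-edges are joined, in their cyclic
order, to the incoming endpoints `1, …, r`. -/
def corolla (r : ℕ) : RibbonGraph r 0 where
  Vert := Unit
  Half := Fin r
  Edge := Fin r
  finite_vert := inferInstance
  finite_half := inferInstance
  finite_edge := inferInstance
  vert _ := ()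
  next := finRotate r
  sameCycle_iff h h' := by
    simp only [iff_true]
    rcases r with _ | _ | n
    · exact h.elim0
    · have : h = h' := by omega
      rw [this]
    · have hc : (finRotate (n + 2)).IsCycle := isCycle_finRotate
      exact hc.sameCycle (by simp) (by simp)
  edge := Sum.elim (Equiv.refl _) (Equiv.sumEmpty _ _)
  other_end := existsUnique_other_of_equiv _ _

/-! ### Juxtaposition -/

/-- The ends of the juxtaposition of two graphs: those of the first graph come first. -/
def juxtEnds {p q p' q' : ℕ} (H H' : Type) :
    (H ⊕ H') ⊕ (Fin (p + p') ⊕ Fin (q + q')) ≃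
      (H ⊕ (Fin p ⊕ Fin q)) ⊕ (H' ⊕ (Fin p' ⊕ Fin q')) :=
  (Equiv.sumCongr (Equiv.refl _)
    ((Equiv.sumCongr finSumFinEquiv.symm finSumFinEquiv.symm).trans
      (Equiv.sumSumSumComm _ _ _ _))).trans (Equiv.sumSumSumComm _ _ _ _)

theorem sameCycle_sumCongr {α β γ δ : Type} (s : Equiv.Perm α) (t : Equiv.Perm β)
    (f : α → γ) (g : β → δ) (hs : ∀ a a', s.SameCycle a a' ↔ f a = f a')
    (ht : ∀ b b', t.SameCycle b b' ↔ g b = g b') (x y : α ⊕ β) :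
    Equiv.Perm.SameCycle (Equiv.sumCongr s t) x y ↔ Sum.map f g x = Sum.map f g y := by
  have key : ∀ i : ℤ, (Equiv.sumCongr s t : Equiv.Perm (α ⊕ β)) ^ i
      = Equiv.sumCongr (s ^ i) (t ^ i) := fun i =>
    (map_zpow (Equiv.Perm.sumCongrHom α β) (s, t) i).symm
  rcases x with x | x <;> rcases y with y | y <;>
    simp [Equiv.Perm.SameCycle, key, ← hs, ← ht]

theorem existsUnique_other_sum {α β γ δ : Type} {f : α → γ} {g : β → δ}
    (hf : ∀ x, ∃! y, y ≠ x ∧ f y = f x) (hg : ∀ x, ∃! y, y ≠ x ∧ g y = g x) (x : α ⊕ β) :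
    ∃! y, y ≠ x ∧ Sum.map f g y = Sum.map f g x := by
  rcases x with x | x
  · obtain ⟨y, hy, hu⟩ := hf x
    refine ⟨Sum.inl y, by simpa using hy, ?_⟩
    rintro (z | z) hz
    · exact congrArg _ (hu z (by simpa using hz))
    · simp at hz
  · obtain ⟨y, hy, hu⟩ := hg x
    refine ⟨Sum.inr y, by simpa using hy, ?_⟩
    rintro (z | z) hz
    · simp at hz
    · exact congrArg _ (hu z (by simpa using hz))

/-- Juxtaposition of two ribbon graphs. -/
def juxt {p q p' q' : ℕ} (G : RibbonGraph p q) (K : RibbonGraph p' q') :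
    RibbonGraph (p + p') (q + q') where
  Vert := G.Vert ⊕ K.Vert
  Half := G.Half ⊕ K.Half
  Edge := G.Edge ⊕ K.Edge
  finite_vert := by
    have := G.finite_vert
    have := K.finite_vert
    infer_instance
  finite_half := by
    have := G.finite_half
    have := K.finite_half
    infer_instance
  finite_edge := by
    have := G.finite_edge
    have := K.finite_edge
    infer_instance
  vert := Sum.map G.vert K.vert
  next := Equiv.sumCongr G.next K.next
  sameCycle_iff := sameCycle_sumCongr _ _ _ _ G.sameCycle_iff K.sameCycle_iff
  edge x := Sum.map G.edge K.edge (juxtEnds G.Half K.Half x)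
  other_end x := by
    obtain ⟨y, hy, hu⟩ := existsUnique_other_sum G.other_end K.other_end
      (juxtEnds G.Half K.Half x)
    refine ⟨(juxtEnds G.Half K.Half).symm y, ⟨fun h => hy.1 ?_, by simpa using hy.2⟩, ?_⟩
    · rw [← h, Equiv.apply_symm_apply]
    · intro z hz
      rw [Equiv.eq_symm_apply]
      exact hu _ ⟨fun h => hz.1 ((juxtEnds G.Half K.Half).injective h), hz.2⟩

/-! ### Composition -/

section Gluing

variable {E A ι : Type} (f : E → A) (s t : ι → E)

/-- Glueing the ends `s i` and `t i` identifies the edges to which they belong. -/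
def GlueRel (S : Set ι) (a b : A) : Prop := ∃ i ∈ S, a = f (s i) ∧ b = f (t i)

variable {f s t}

theorem eqvGen_glueRel_insert {S : Set ι} {j : ι} {a b : A}
    (h : Relation.EqvGen (GlueRel f s t (insert j S)) a b) :
    Relation.EqvGen (GlueRel f s t S) a b ∨
      (Relation.EqvGen (GlueRel f s t S) a (f (s j)) ∧
        Relation.EqvGen (GlueRel f s t S) b (f (t j))) ∨
      (Relation.EqvGen (GlueRel f s t S) a (f (t j)) ∧
        Relation.EqvGen (GlueRel f s t S) b (f (s j))) := by
  have hr : ∀ a, Relation.EqvGen (GlueRel f s t S) a a := Relation.EqvGen.refl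
  have hs : ∀ a b, Relation.EqvGen (GlueRel f s t S) a b →
      Relation.EqvGen (GlueRel f s t S) b a := Relation.EqvGen.symm
  have ht : ∀ a b c, Relation.EqvGen (GlueRel f s t S) a b →
      Relation.EqvGen (GlueRel f s t S) b c → Relation.EqvGen (GlueRel f s t S) a c :=
    Relation.EqvGen.trans
  induction h with
  | rel x y h =>
    obtain ⟨i, hi, rfl, rfl⟩ := h
    rcases hi with rfl | hi
    · exact Or.inr (Or.inl ⟨hr _, hr _⟩)
    · exact Or.inl (Relation.EqvGen.rel _ _ ⟨i, hi, rfl, rfl⟩)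
  | refl x => exact Or.inl (hr x)
  | symm x y _ ih => grind
  | trans x y z _ _ ih1 ih2 => grind

theorem eqvGen_glueRel_mono {S S' : Set ι} (hS : S ⊆ S') {a b : A}
    (h : Relation.EqvGen (GlueRel f s t S) a b) : Relation.EqvGen (GlueRel f s t S') a b :=
  Relation.EqvGen.mono (fun _ _ ⟨i, hi, h⟩ => ⟨i, hS hi, h⟩) _ _ h

/-- After some ends have been glued in pairs, every remaining end still has exactly one partner. -/
theorem existsUnique_other_glue (hf : ∀ x, ∃! y, y ≠ x ∧ f y = f x)
    (hs : Function.Injective s) (ht : Function.Injective t) (hst : ∀ i j, s i ≠ t j)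
    {S : Set ι} (hS : S.Finite) :
    ∀ x, (∀ i ∈ S, x ≠ s i ∧ x ≠ t i) →
      ∃! y, (∀ i ∈ S, y ≠ s i ∧ y ≠ t i) ∧ y ≠ x ∧
        Relation.EqvGen (GlueRel f s t S) (f y) (f x) := by
  induction S, hS using Set.Finite.induction_on with
  | empty =>
    intro x _
    obtain ⟨y, hy, hu⟩ := hf x
    have key : ∀ a b, Relation.EqvGen (GlueRel f s t ∅) a b → a = b := by
      intro a b h
      induction h with
      | rel x y h =>
        obtain ⟨i, hi, _⟩ := h
        exact hi.elim
      | refl x => rfl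
      | symm x y _ ih => exact ih.symm
      | trans x y z _ _ ih1 ih2 => exact ih1.trans ih2
    refine ⟨y, ⟨fun i hi => hi.elim, hy.1, ?_⟩, fun z hz => hu z ⟨hz.2.1, key _ _ hz.2.2⟩⟩
    rw [hy.2]
    exact Relation.EqvGen.refl _
  | @insert j S hj _ ih =>
    intro x hx
    have er : ∀ a, Relation.EqvGen (GlueRel f s t S) a a := Relation.EqvGen.refl
    have es : ∀ a b, Relation.EqvGen (GlueRel f s t S) a b →
        Relation.EqvGen (GlueRel f s t S) b a := Relation.EqvGen.symm
    have et : ∀ a b c, Relation.EqvGen (GlueRel f s t S) a b →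
        Relation.EqvGen (GlueRel f s t S) b c → Relation.EqvGen (GlueRel f s t S) a c :=
      Relation.EqvGen.trans
    have em : ∀ a b, Relation.EqvGen (GlueRel f s t S) a b →
        Relation.EqvGen (GlueRel f s t (insert j S)) a b := fun a b h =>
      eqvGen_glueRel_mono (Set.subset_insert j S) h
    have es' : ∀ a b, Relation.EqvGen (GlueRel f s t (insert j S)) a b →
        Relation.EqvGen (GlueRel f s t (insert j S)) b a := Relation.EqvGen.symm
    have et' : ∀ a b c, Relation.EqvGen (GlueRel f s t (insert j S)) a b →
        Relation.EqvGen (GlueRel f s t (insert j S)) b c →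
        Relation.EqvGen (GlueRel f s t (insert j S)) a c := Relation.EqvGen.trans
    have ej : Relation.EqvGen (GlueRel f s t (insert j S)) (f (s j)) (f (t j)) :=
      Relation.EqvGen.rel _ _ ⟨j, Set.mem_insert j S, rfl, rfl⟩
    have ei : ∀ a b, Relation.EqvGen (GlueRel f s t (insert j S)) a b →
      Relation.EqvGen (GlueRel f s t S) a b ∨
      (Relation.EqvGen (GlueRel f s t S) a (f (s j)) ∧
        Relation.EqvGen (GlueRel f s t S) b (f (t j))) ∨
      (Relation.EqvGen (GlueRel f s t S) a (f (t j)) ∧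
        Relation.EqvGen (GlueRel f s t S) b (f (s j))) := fun a b => eqvGen_glueRel_insert
    have live : ∀ z, (∀ i ∈ insert j S, z ≠ s i ∧ z ≠ t i) ↔
        (z ≠ s j ∧ z ≠ t j) ∧ ∀ i ∈ S, z ≠ s i ∧ z ≠ t i := by
      intro z
      exact Set.forall_mem_insert
    have hsl : ∀ i ∈ S, s j ≠ s i ∧ s j ≠ t i := fun i hi =>
      ⟨fun h => hj (hs h ▸ hi), hst j i⟩
    have htl : ∀ i ∈ S, t j ≠ s i ∧ t j ≠ t i := fun i hi =>
      ⟨(hst i j).symm, fun h => hj (ht h ▸ hi)⟩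
    have hne := hst j j
    rw [live] at hx
    simp only [live]
    generalize Relation.EqvGen (GlueRel f s t (insert j S)) = R' at *
    generalize Relation.EqvGen (GlueRel f s t S) = R at *
    generalize s j = a at *
    generalize t j = b at *
    obtain ⟨y, ⟨hy1, hy2, hy3⟩, hyu⟩ := ih x hx.2
    obtain ⟨c, ⟨hc1, hc2, hc3⟩, hcu⟩ := ih a hsl
    obtain ⟨d, ⟨hd1, hd2, hd3⟩, hdu⟩ := ih b htl
    by_cases hya : y = a
    · refine ⟨d, ⟨⟨⟨?_, hd2⟩, hd1⟩, ?_, ?_⟩, ?_⟩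
      all_goals grind
    · by_cases hyb : y = b
      · refine ⟨c, ⟨⟨⟨hc2, ?_⟩, hc1⟩, ?_, ?_⟩, ?_⟩
        all_goals grind
      · refine ⟨y, ⟨⟨⟨hya, hyb⟩, hy1⟩, hy2, em _ _ hy3⟩, ?_⟩
        grind

end Gluing

section Comp

variable {p q r : ℕ}

/-- When `G` is stacked on top of `K`, the edge of `G` at the `i`-th incoming endpoint is continued
by the edge of `K` at the `i`-th outgoing endpoint. -/
def CompRel (G : RibbonGraph q r) (K : RibbonGraph p q) (a b : G.Edge ⊕ K.Edge) : Prop :=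
  ∃ i : Fin q, a = Sum.inl (G.edge (Sum.inr (Sum.inl i))) ∧
    b = Sum.inr (K.edge (Sum.inr (Sum.inr i)))

/-- The ends of a composite graph, as ends of the two graphs of which it is composed. -/
def compEnds (H H' : Type) :
    (H ⊕ H') ⊕ (Fin p ⊕ Fin r) → (H ⊕ (Fin q ⊕ Fin r)) ⊕ (H' ⊕ (Fin p ⊕ Fin q))
  | Sum.inl (Sum.inl h) => Sum.inl (Sum.inl h)
  | Sum.inl (Sum.inr h) => Sum.inr (Sum.inl h)
  | Sum.inr (Sum.inl i) => Sum.inr (Sum.inr (Sum.inl i))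
  | Sum.inr (Sum.inr j) => Sum.inl (Sum.inr (Sum.inr j))

/-- Composition of ribbon graphs: `comp G K` is `G` stacked on top of `K`, the incoming endpoints of
`G` being glued to the outgoing endpoints of `K`. The edges of the result are the classes of
edges of `G` and `K` that are joined, successively, at the glued points. -/
def comp (G : RibbonGraph q r) (K : RibbonGraph p q) : RibbonGraph p r where
  Vert := G.Vert ⊕ K.Vert
  Half := G.Half ⊕ K.Half
  Edge := Quot (CompRel G K)
  finite_vert := by
    have := G.finite_vert
    have := K.finite_vert
    infer_instance
  finite_half := by
    have := G.finite_half
    have := K.finite_half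
    infer_instance
  finite_edge := by
    have := G.finite_edge
    have := K.finite_edge
    exact Quot.finite _
  vert := Sum.map G.vert K.vert
  next := Equiv.sumCongr G.next K.next
  sameCycle_iff := sameCycle_sumCongr _ _ _ _ G.sameCycle_iff K.sameCycle_iff
  edge x := Quot.mk _ (Sum.map G.edge K.edge (compEnds G.Half K.Half x))
  other_end x := by
    have key := existsUnique_other_glue
      (s := fun i : Fin q => (Sum.inl (Sum.inr (Sum.inl i)) :
        (G.Half ⊕ (Fin q ⊕ Fin r)) ⊕ (K.Half ⊕ (Fin p ⊕ Fin q))))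
      (t := fun i : Fin q => Sum.inr (Sum.inr (Sum.inr i)))
      (existsUnique_other_sum G.other_end K.other_end)
      (fun i j h => by simpa using h) (fun i j h => by simpa using h) (fun i j => by simp)
      (Set.finite_univ (α := Fin q))
    have hrel : GlueRel (Sum.map G.edge K.edge)
        (fun i : Fin q => (Sum.inl (Sum.inr (Sum.inl i)) :
          (G.Half ⊕ (Fin q ⊕ Fin r)) ⊕ (K.Half ⊕ (Fin p ⊕ Fin q))))
        (fun i : Fin q => Sum.inr (Sum.inr (Sum.inr i))) Set.univ = CompRel G K := by
      funext a b
      simp [GlueRel, CompRel]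
    rw [hrel] at key
    have hlive : ∀ z : (G.Half ⊕ K.Half) ⊕ (Fin p ⊕ Fin r), ∀ i ∈ (Set.univ : Set (Fin q)),
        compEnds G.Half K.Half z ≠ Sum.inl (Sum.inr (Sum.inl i)) ∧
        compEnds G.Half K.Half z ≠ Sum.inr (Sum.inr (Sum.inr i)) := by
      rintro ((z | z) | (z | z)) i - <;> simp [compEnds]
    have hinj : Function.Injective (compEnds (p := p) (q := q) (r := r) G.Half K.Half) := by
      rintro ((y | y) | (y | y)) ((z | z) | (z | z)) h <;> simp_all [compEnds]
    have hsurj : ∀ w, (∀ i ∈ (Set.univ : Set (Fin q)), w ≠ Sum.inl (Sum.inr (Sum.inl i)) ∧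
        w ≠ Sum.inr (Sum.inr (Sum.inr i))) →
        ∃ z, compEnds (p := p) (q := q) (r := r) G.Half K.Half z = w := by
      rintro ((w | (w | w)) | (w | (w | w))) h
      · exact ⟨Sum.inl (Sum.inl w), rfl⟩
      · exact absurd rfl (h w trivial).1
      · exact ⟨Sum.inr (Sum.inr w), rfl⟩
      · exact ⟨Sum.inl (Sum.inr w), rfl⟩
      · exact ⟨Sum.inr (Sum.inl w), rfl⟩
      · exact absurd rfl (h w trivial).2
    obtain ⟨w, ⟨hw1, hw2, hw3⟩, hwu⟩ := key _ (hlive x)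
    obtain ⟨y, rfl⟩ := hsurj w hw1
    refine ⟨y, ⟨fun h => hw2 (congrArg _ h), Quot.eqvGen_sound hw3⟩, ?_⟩
    rintro z ⟨hz1, hz2⟩
    exact hinj (hwu _ ⟨hlive z, fun h => hz1 (hinj h), Quot.eqvGen_exact hz2⟩)

end Comp

/-! ### The operations respect isomorphism -/

/-- Juxtaposition of isomorphisms. -/
def Iso.juxt {p q p' q' : ℕ} {G G' : RibbonGraph p q} {K K' : RibbonGraph p' q'}
    (e : Iso G G') (d : Iso K K') : Iso (G.juxt K) (G'.juxt K') where
  onVert := Equiv.sumCongr e.onVert d.onVert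
  onHalf := Equiv.sumCongr e.onHalf d.onHalf
  onEdge := Equiv.sumCongr e.onEdge d.onEdge
  vert_eq h := by
    rcases h with h | h
    · exact congrArg Sum.inl (e.vert_eq h)
    · exact congrArg Sum.inr (d.vert_eq h)
  next_eq h := by
    rcases h with h | h
    · exact congrArg Sum.inl (e.next_eq h)
    · exact congrArg Sum.inr (d.next_eq h)
  edge_eq x := by
    have key : ∀ x : (G.Half ⊕ K.Half) ⊕ (Fin (p + p') ⊕ Fin (q + q')),
        juxtEnds G'.Half K'.Half (Sum.map (Equiv.sumCongr e.onHalf d.onHalf) id x) =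
        Sum.map (Sum.map e.onHalf id) (Sum.map d.onHalf id) (juxtEnds G.Half K.Half x) := by
      rintro ((x | x) | (x | x))
      · rfl
      · rfl
      · induction x using Fin.addCases <;> simp [juxtEnds]
      · induction x using Fin.addCases <;> simp [juxtEnds]
    refine (congrArg (Sum.map G'.edge K'.edge) (key x)).trans ?_
    change _ = Equiv.sumCongr _ _ (Sum.map _ _ (juxtEnds _ _ x))
    rcases juxtEnds G.Half K.Half x with y | y
    · exact congrArg Sum.inl (e.edge_eq y)
    · exact congrArg Sum.inr (d.edge_eq y)

/-- Composition of graphs respects isomorphism. -/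
def Iso.comp {p q r : ℕ} {G G' : RibbonGraph q r} {K K' : RibbonGraph p q}
    (e : Iso G G') (d : Iso K K') : Iso (G.comp K) (G'.comp K') where
  onVert := Equiv.sumCongr e.onVert d.onVert
  onHalf := Equiv.sumCongr e.onHalf d.onHalf
  onEdge := Quot.congr (Equiv.sumCongr e.onEdge d.onEdge) (by
    intro a b
    have he : ∀ i : Fin q, e.onEdge (G.edge (Sum.inr (Sum.inl i))) =
        G'.edge (Sum.inr (Sum.inl i)) := fun i => (e.edge_eq _).symm
    have hd : ∀ i : Fin q, d.onEdge (K.edge (Sum.inr (Sum.inr i))) =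
        K'.edge (Sum.inr (Sum.inr i)) := fun i => (d.edge_eq _).symm
    refine exists_congr fun i => ?_
    rcases a with a | a <;> rcases b with b | b <;> simp [← he, ← hd])
  vert_eq h := by
    rcases h with h | h
    · exact congrArg Sum.inl (e.vert_eq h)
    · exact congrArg Sum.inr (d.vert_eq h)
  next_eq h := by
    rcases h with h | h
    · exact congrArg Sum.inl (e.next_eq h)
    · exact congrArg Sum.inr (d.next_eq h)
  edge_eq x := by
    refine congrArg (Quot.mk _) ?_
    rcases x with ((x | x) | (x | x))
    · exact congrArg Sum.inl (e.edge_eq (Sum.inl x))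
    · exact congrArg Sum.inr (d.edge_eq (Sum.inl x))
    · exact congrArg Sum.inr (d.edge_eq (Sum.inr (Sum.inl x)))
    · exact congrArg Sum.inl (e.edge_eq (Sum.inr (Sum.inr x)))

end RibbonGraph

/-! ## The PROP of ribbon graphs -/

/-- Isomorphism classes of ribbon graphs of type `(p, q)`. -/
abbrev RibbonClass (p q : ℕ) : Type 1 := Quotient (RibbonGraph.isoSetoid p q)

namespace RibbonClass

/-- Composition of isomorphism classes. -/
def comp {p q r : ℕ} : RibbonClass q r → RibbonClass p q → RibbonClass p r :=
  Quotient.map₂ RibbonGraph.comp fun _ _ ⟨e⟩ _ _ ⟨d⟩ => ⟨e.comp d⟩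

/-- Juxtaposition of isomorphism classes. -/
def juxt {p q p' q' : ℕ} : RibbonClass p q → RibbonClass p' q' → RibbonClass (p + p') (q + q') :=
  Quotient.map₂ RibbonGraph.juxt fun _ _ ⟨e⟩ _ _ ⟨d⟩ => ⟨e.juxt d⟩

end RibbonClass

/-- The space `RG(p, q)`: the linear span of the ribbon graphs of type `(p, q)`. -/
abbrev RG (k : Type u) [Field k] (p q : ℕ) : Type (max 1 u) := RibbonClass p q →₀ k

namespace RG

variable (k : Type u) [Field k]

/-- A ribbon graph as an element of `RG(p, q)`. -/
noncomputable def of {p q : ℕ} (G : RibbonGraph p q) : RG k p q := Finsupp.single ⟦G⟧ 1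

variable {k}

/-- Composition in the PROP of ribbon graphs, the bilinear extension of stacking. -/
noncomputable def comp {p q r : ℕ} : RG k q r →ₗ[k] RG k p q →ₗ[k] RG k p r :=
  Finsupp.linearCombination k fun G : RibbonClass q r => Finsupp.lmapDomain k k fun K => G.comp K

/-- Tensor product in the PROP of ribbon graphs, the bilinear extension of juxtaposition. -/
noncomputable def tensor {p q p' q' : ℕ} :
    RG k p q →ₗ[k] RG k p' q' →ₗ[k] RG k (p + p') (q + q') :=
  Finsupp.linearCombination k fun G : RibbonClass p q => Finsupp.lmapDomain k k fun K => G.juxt K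

end RG

/-! ## The endomorphism PROP of a vector space -/

/-- The space `Hom(V^{⊗p}, V^{⊗q})`. -/
abbrev EndProp (k : Type u) [Field k] (V : Type v) [AddCommGroup V] [Module k V] (p q : ℕ) :
    Type (max u v) :=
  (⨂[k]^p V) →ₗ[k] (⨂[k]^q V)

namespace EndProp

variable {k : Type u} [Field k] {V : Type v} [AddCommGroup V] [Module k V]

/-- Tensor product of linear maps, under the canonical identification of
`V^{⊗p} ⊗ V^{⊗p'}` with `V^{⊗(p + p')}`. -/
noncomputable def tensor {p q p' q' : ℕ} (f : EndProp k V p q) (g : EndProp k V p' q') :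
    EndProp k V (p + p') (q + q') :=
  TensorPower.mulEquiv.toLinearMap ∘ₗ TensorProduct.map f g ∘ₗ
    TensorPower.mulEquiv.symm.toLinearMap

variable (k V)

/-- The exchange `x ⊗ y ↦ y ⊗ x` of `V^{⊗m}` and `V^{⊗n}`. -/
noncomputable def braiding (m n : ℕ) : EndProp k V (m + n) (n + m) :=
  TensorPower.mulEquiv.toLinearMap ∘ₗ (TensorProduct.comm k (⨂[k]^m V) (⨂[k]^n V)).toLinearMap ∘ₗ
    TensorPower.mulEquiv.symm.toLinearMap

/-- The canonical identification of `V^{⊗0}` with the ground field. -/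
noncomputable def scalar : (⨂[k]^0 V) ≃ₗ[k] k := PiTensorProduct.isEmptyEquiv (Fin 0)

end EndProp

/-! ## Algebras over the PROP of ribbon graphs, and cyclic algebras -/

section Algebras

variable (k : Type u) [Field k] (V : Type v) [AddCommGroup V] [Module k V]

/-- An `RG`-algebra structure on `V`: a morphism of symmetric linear PROPs from the PROP of ribbon
graphs to the endomorphism PROP of `V`. -/
@[ext]
structure RGAlgebra where
  /-- the operator of a (linear combination of) ribbon graphs -/
  act : ∀ {p q : ℕ}, RG k p q →ₗ[k] EndProp k V p q
  act_strands : ∀ n : ℕ, act (RG.of k (RibbonGraph.strands n)) = LinearMap.id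
  act_comp : ∀ {p q r : ℕ} (x : RG k q r) (y : RG k p q), act (RG.comp x y) = act x ∘ₗ act y
  act_tensor : ∀ {p q p' q' : ℕ} (x : RG k p q) (y : RG k p' q'),
    act (RG.tensor x y) = EndProp.tensor (act x) (act y)
  act_crossing : ∀ m n : ℕ, act (RG.of k (RibbonGraph.crossing m n)) = EndProp.braiding k V m n

/-- A cyclic algebra structure on `V`: a nondegenerate symmetric inner product `b` and a sequence of
cyclically invariant linear maps `T r : V^{⊗r} → k`. Nondegeneracy means that `b` identifies `V`
with its dual. -/
@[ext]
structure CyclicAlgebra where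
  /-- the inner product -/
  b : V →ₗ[k] V →ₗ[k] k
  symm : ∀ x y, b x y = b y x
  nondegenerate : b.IsPerfPair
  /-- the cyclic tensors -/
  T : ∀ r : ℕ, (⨂[k]^r V) →ₗ[k] k
  /-- `T r (x₁ ⊗ ⋯ ⊗ xᵣ) = T r (xᵣ ⊗ x₁ ⊗ ⋯ ⊗ xᵣ₋₁)` -/
  cyclic : ∀ (r : ℕ) (x : Fin r → V),
    T r (PiTensorProduct.tprod k x) = T r (PiTensorProduct.tprod k (x ∘ (finRotate r).symm))

end Algebras

/-! From `RG`-algebras to cyclic algebras, the axioms come from relations between small graphs. An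
arc with its endpoints crossed is still an arc, so `b` is symmetric; a corolla with rotated
endpoints is isomorphic to itself, so `T r` is cyclically invariant. An arc glued to a `coarc` (an
arc with two outgoing endpoints) is a zigzag that straightens to a strand, so contracting `b x` with
the value of the `coarc` returns `x` (`contractLeft_copairing`). Hence `x ↦ b x` is injective, and
`V` is spanned by the finitely many vectors occurring in one tensor, which makes `b` perfect.

The correspondence is injective because strands, crossings, `arc`, `coarc` and corollas generate all
graphs (`RibbonGraph.generated`): cutting the edges exhibits a graph as a vertexless wiring followed
by corollas and strands. Strands and crossings have prescribed values, arc and corollas are recorded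
by `b` and `T`, and the zigzag relation determines the value of the `coarc` from `b`
(`copairing_eq`).

It is surjective by a state sum. Take a pair of dual bases, give opposite signs to the two ends of
each arc, colour the edges by basis indices, and place vectors of one basis or the other at the ends
according to sign. Evaluate `T` at the vertices, pair the inputs by `b`, read off the outputs and
sum over colourings. Symmetry of `b` makes the signs irrelevant
(`sum_multilinear_eq_of_isOrientation`), cyclicity of `T` the listing of half-edges. For a composite
(`stateSum_comp`), glued ends are given opposite signs, so their pairing is a Kronecker delta; the
surviving colourings are exactly those of the glued edges. -/

/-! ## Cyclic numberings of the half-edges at a vertex -/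

/-- `ν` lists the elements of the fibre of `vert` over `v`, in the cyclic order given by `next`. -/
structure IsCyclicNumbering {H W : Type} (next : Equiv.Perm H) (vert : H → W) (v : W) {r : ℕ}
    (ν : Fin r → H) : Prop where
  injective : Function.Injective ν
  vert_eq_iff : ∀ h, vert h = v ↔ ∃ i, ν i = h
  next_eq : ∀ i, next (ν i) = ν (finRotate r i)

namespace IsCyclicNumbering

variable {H W : Type} {next : Equiv.Perm H} {vert : H → W}

/-- Iterating `next` from one half-edge runs through its whole cycle, and the minimal period is the
valence. An empty fibre, that is an isolated vertex, has valence `0`. -/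
theorem exists_of_sameCycle [Finite H]
    (hc : ∀ h h', next.SameCycle h h' ↔ vert h = vert h') (v : W) :
    ∃ (r : ℕ) (ν : Fin r → H), IsCyclicNumbering next vert v ν := by
  by_cases hv : ∃ h, vert h = v
  · obtain ⟨h₀, rfl⟩ := hv
    have hper : h₀ ∈ Function.periodicPts next := by
      refine ⟨orderOf next, orderOf_pos next, ?_⟩
      rw [Function.IsPeriodicPt, Function.IsFixedPt, ← Equiv.Perm.coe_pow, pow_orderOf_eq_one]
      rfl
    have hpos := Function.minimalPeriod_pos_of_mem_periodicPts hper
    obtain ⟨n, hn⟩ : ∃ n, Function.minimalPeriod next h₀ = n + 1 :=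
      ⟨_, (Nat.succ_pred_eq_of_pos hpos).symm⟩
    refine ⟨n + 1, fun i => next^[i] h₀, ?_, ?_, ?_⟩
    · intro i j hij
      exact Fin.ext (Function.iterate_injOn_Iio_minimalPeriod (f := next) (x := h₀)
        (by rw [Set.mem_Iio, hn]; exact i.2) (by rw [Set.mem_Iio, hn]; exact j.2) hij)
    · intro h
      rw [eq_comm, ← hc]
      constructor
      · intro hs
        obtain ⟨i, -, hi⟩ := hs.exists_pow_eq'
        refine ⟨⟨i % (n + 1), Nat.mod_lt _ n.succ_pos⟩, ?_⟩
        change next^[i % (n + 1)] h₀ = h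
        rw [← hi, Equiv.Perm.coe_pow, ← hn]
        exact Function.iterate_mod_minimalPeriod_eq
      · rintro ⟨i, rfl⟩
        exact ⟨i, by rw [zpow_natCast, Equiv.Perm.coe_pow]⟩
    · intro i
      rw [coe_finRotate]
      split_ifs with hi
      · subst hi
        rw [← Function.iterate_succ_apply' next, Fin.val_last, Nat.succ_eq_add_one, ← hn]
        exact Function.iterate_minimalPeriod
      · rw [Function.iterate_succ_apply']
  · refine ⟨0, Fin.elim0, fun i => i.elim0, fun h => ?_, fun i => i.elim0⟩
    exact ⟨fun hh => (hv ⟨h, hh⟩).elim, fun ⟨i, _⟩ => i.elim0⟩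

/-- Used to transport numberings along isomorphisms and along the inclusions of the two factors of a
juxtaposition or composite. -/
theorem map {H' W' : Type} {next' : Equiv.Perm H'} {vert' : H' → W'} {v : W} {v' : W'} {r : ℕ}
    {ν : Fin r → H} (h : IsCyclicNumbering next vert v ν) (f : H → H')
    (hf : Function.Injective f) (hnext : ∀ x, next' (f x) = f (next x))
    (hvert : ∀ y, vert' y = v' ↔ ∃ x, vert x = v ∧ f x = y) :
    IsCyclicNumbering next' vert' v' (f ∘ ν) where
  injective := hf.comp h.injective
  vert_eq_iff y := by
    rw [hvert]
    constructor
    · rintro ⟨x, hx, rfl⟩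
      obtain ⟨i, rfl⟩ := (h.vert_eq_iff x).1 hx
      exact ⟨i, rfl⟩
    · rintro ⟨i, rfl⟩
      exact ⟨ν i, (h.vert_eq_iff _).2 ⟨i, rfl⟩, rfl⟩
  next_eq i := by simp [hnext, h.next_eq]

theorem card_eq {v : W} {r r' : ℕ} {ν : Fin r → H} {ν' : Fin r' → H}
    (h : IsCyclicNumbering next vert v ν) (h' : IsCyclicNumbering next vert v ν') : r = r' := by
  have hr : Set.range ν = Set.range ν' := by
    ext x
    exact (h.vert_eq_iff x).symm.trans (h'.vert_eq_iff x)
  have e := (Equiv.ofInjective ν h.injective).trans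
    ((Equiv.setCongr hr).trans (Equiv.ofInjective ν' h'.injective).symm)
  simpa using Fintype.card_congr e

end IsCyclicNumbering

/-! ### Cyclic tensors evaluated on cyclically ordered vectors -/

section Amplitude

variable {k : Type u} [Field k] {V : Type v} [AddCommGroup V] [Module k V]

namespace CyclicAlgebra

variable (C : CyclicAlgebra k V)

/-- Rotation by one step is translation by `1` in `Fin (n + 1)`, so the axiom `cyclic` iterates to
all translations. -/
theorem T_add_right {n : ℕ} (x : Fin (n + 1) → V) (m : Fin (n + 1)) :
    C.T (n + 1) (PiTensorProduct.tprod k fun i => x (i + m)) =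
      C.T (n + 1) (PiTensorProduct.tprod k x) := by
  induction m using Fin.induction generalizing x with
  | zero => simp
  | succ m ih =>
    refine (C.cyclic _ _).trans (Eq.trans ?_ (ih x))
    congr 2
    funext i
    have : ∀ j : Fin (n + 1), (finRotate (n + 1)).symm j = j - 1 := fun j => by
      rw [Equiv.symm_apply_eq, finRotate_apply, sub_add_cancel]
    simp only [Function.comp_apply, this, Fin.coeSucc_eq_succ.symm]
    congr 1
    abel

/-- A cyclic numbering is determined by its first element, so two numberings of one vertex differ by
a translation; `m` below is the position in `ν` of the first element of `ν'`. -/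
theorem T_eq_of_isCyclicNumbering {H W : Type} {next : Equiv.Perm H} {vert : H → W} {v : W}
    {r r' : ℕ} {ν : Fin r → H} {ν' : Fin r' → H} (h : IsCyclicNumbering next vert v ν)
    (h' : IsCyclicNumbering next vert v ν') (w : H → V) :
    C.T r (PiTensorProduct.tprod k (w ∘ ν)) = C.T r' (PiTensorProduct.tprod k (w ∘ ν')) := by
  obtain rfl := h.card_eq h'
  rcases r with _ | n
  · congr 2
    exact Subsingleton.elim _ _
  · obtain ⟨m, hm⟩ := (h.vert_eq_iff (ν' 0)).1 ((h'.vert_eq_iff _).2 ⟨0, rfl⟩)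
    have key : ∀ i, ν' i = ν (i + m) := by
      intro i
      induction i using Fin.induction with
      | zero => simp [hm]
      | succ i ih =>
        rw [← Fin.coeSucc_eq_succ, ← finRotate_apply, ← h'.next_eq, ih, h.next_eq,
          finRotate_apply, finRotate_apply]
        congr 1
        abel
    rw [← C.T_add_right _ m]
    congr 2
    funext i
    simp [key]

end CyclicAlgebra

/-! ## The pairing of a tensor with a family of vectors -/

/-- The functional `x₁ ⊗ ⋯ ⊗ xₙ ↦ ∏ b(xᵢ, yᵢ)`. -/
noncomputable def tensorPairing (b : V →ₗ[k] V →ₗ[k] k) {n : ℕ} (y : Fin n → V) :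
    (⨂[k]^n V) →ₗ[k] k :=
  PiTensorProduct.lift ((MultilinearMap.mkPiAlgebra k (Fin n) k).compLinearMap
    fun i => b.flip (y i))

@[simp]
theorem tensorPairing_tprod (b : V →ₗ[k] V →ₗ[k] k) {n : ℕ} (y x : Fin n → V) :
    tensorPairing b y (PiTensorProduct.tprod k x) = ∏ i, b (x i) (y i) := by
  simp [tensorPairing]

/-- A pair of bases indexed by `I`, labelled by the two signs, that are dual for `b`. -/
structure DualFrame (b : V →ₗ[k] V →ₗ[k] k) (I : Type) [Fintype I] [DecidableEq I] where
  vec : Bool → I → V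
  pairing : ∀ s i j, b (vec s i) (vec (!s) j) = if i = j then 1 else 0
  expand : ∀ s x, ∑ i, b x (vec (!s) i) • vec s i = x

namespace DualFrame

variable {b : V →ₗ[k] V →ₗ[k] k} {I : Type} [Fintype I] [DecidableEq I] (D : DualFrame b I)

/-- Expand `x` in the frame. The right-hand side does not involve `s`, which is why the sum over the
colour of an arc does not depend on its orientation. -/
theorem parseval (s : Bool) (x y : V) :
    ∑ i, b x (D.vec (!s) i) * b (D.vec s i) y = b x y := by
  conv_rhs => rw [← D.expand s x]
  simp

end DualFrame

/-! ## Orientations of the edges -/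

/-- A choice of signs of the ends such that the two ends of each edge have opposite signs. -/
def IsOrientation {E A : Type} (f : E → A) (σ : E → Bool) : Prop :=
  ∀ x y, x ≠ y → f x = f y → σ y = !σ x

theorem exists_isOrientation {E A : Type} {f : E → A} (hf : ∀ x, ∃! y, y ≠ x ∧ f y = f x) :
    ∃ σ, IsOrientation f σ := by
  classical
  -- `R x` is a chosen end of the edge of `x`; chosen ends get the sign `true`. An edge has only two
  -- ends, so exactly one of them is chosen.
  let R : E → E := fun x => Set.rangeSplitting f ⟨f x, x, rfl⟩
  have hR : ∀ x, f (R x) = f x := fun x => Set.apply_rangeSplitting f _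
  have hRR : ∀ x y, f x = f y → R x = R y := by
    intro x y h
    simp only [R, h]
  refine ⟨fun x => decide (R x = x), fun x y hxy h => ?_⟩
  have h1 := hRR x y h
  by_cases hx : R x = x
  · have : R y ≠ y := fun hy => hxy (by rw [← hx, h1, hy])
    simp [hx, this]
  · obtain ⟨z, -, hz⟩ := hf x
    have hy : R y = y := by
      rw [← h1, hz y ⟨hxy.symm, h.symm⟩]
      exact hz _ ⟨hx, hR x⟩
    simp [hx, hy]

/-- Exchanging the roles of the dual bases along some edges does not change a contraction. -/
theorem sum_multilinear_eq_of_isOrientation {b : V →ₗ[k] V →ₗ[k] k} {I : Type} [Fintype I]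
    [DecidableEq I] (hb : ∀ x y, b x y = b y x) (D : DualFrame b I) {E A : Type} [Fintype E]
    [Fintype A] [DecidableEq A]
    {f : E → A} (hf : ∀ x, ∃! y, y ≠ x ∧ f y = f x) {M : Type*} [AddCommGroup M] [Module k M]
    (Φ : MultilinearMap k (fun _ : E => V) M) {σ τ : E → Bool} (hσ : IsOrientation f σ)
    (hτ : IsOrientation f τ) :
    ∑ d : A → I, Φ (fun x => D.vec (σ x) (d (f x))) =
      ∑ d : A → I, Φ (fun x => D.vec (τ x) (d (f x))) := by
  classical
  -- Expanding every vector in the basis `D.vec true` confines the dependence on `σ` to scalar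
  -- coefficients, which factor over the edges.
  have expand : ∀ σ : E → Bool, ∑ d : A → I, Φ (fun x => D.vec (σ x) (d (f x))) =
      ∑ c : E → I, (∏ a, ∑ i, ∏ x : {x // f x = a}, b (D.vec (σ x) i) (D.vec false (c x))) •
        Φ (fun x => D.vec true (c x)) := by
    intro σ
    calc _ = ∑ d : A → I, ∑ c : E → I,
          (∏ x, b (D.vec (σ x) (d (f x))) (D.vec false (c x))) •
            Φ (fun x => D.vec true (c x)) := by
          refine Finset.sum_congr rfl fun d _ => ?_
          conv_lhs => enter [2, x]; rw [← D.expand true (D.vec (σ x) (d (f x)))]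
          rw [Φ.map_sum]
          exact Finset.sum_congr rfl fun c _ => Φ.map_smul_univ _ _
      _ = _ := by
          rw [Finset.sum_comm]
          refine Finset.sum_congr rfl fun c _ => ?_
          rw [← Finset.sum_smul, Fintype.prod_sum]
          congr 1
          refine Finset.sum_congr rfl fun d _ => ?_
          rw [← Fintype.prod_fiberwise f]
          refine Finset.prod_congr rfl fun a _ => Finset.prod_congr rfl fun x _ => ?_
          rw [x.2]
  rw [expand, expand]
  refine Finset.sum_congr rfl fun c _ => ?_
  congr 1
  refine Finset.prod_congr rfl fun a _ => ?_
  by_cases ha : ∃ x, f x = a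
  · obtain ⟨x, rfl⟩ := ha
    obtain ⟨y, ⟨hyx, hy⟩, hu⟩ := hf x
    have key : ∀ σ, IsOrientation f σ →
        ∑ i, ∏ z : {z // f z = f x}, b (D.vec (σ z) i) (D.vec false (c z)) =
          b (D.vec false (c x)) (D.vec false (c y)) := by
      intro σ hσ
      -- The fibre over an edge with an end consists of `x` and its partner `y`, so the coefficient
      -- is a two-factor sum, evaluated by `parseval`.
      have huniv : (Finset.univ : Finset {z // f z = f x}) = {⟨x, rfl⟩, ⟨y, hy⟩} := by
        ext ⟨z, hz⟩
        simp only [Finset.mem_univ, Finset.mem_insert, Subtype.mk.injEq, Finset.mem_singleton,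
          true_iff]
        by_cases hzx : z = x
        · exact Or.inl hzx
        · exact Or.inr (hu z ⟨hzx, hz⟩)
      rw [← D.parseval (!σ x)]
      refine Finset.sum_congr rfl fun i _ => ?_
      rw [huniv, Finset.prod_pair (by simpa using hyx.symm), hσ x y hyx.symm hy.symm,
        hb (D.vec (σ x) i), Bool.not_not]
    rw [key σ hσ, key τ hτ]
  -- A closed circle carries no vectors: each colour contributes an empty product.
  · have : IsEmpty {x // f x = a} := ⟨fun x => ha ⟨x.1, x.2⟩⟩
    simp

end Amplitude

/-! ## The contraction of a ribbon graph -/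

section Contraction

variable {k : Type u} [Field k] {V : Type v} [AddCommGroup V] [Module k V]

/-- `tensorPairing` as a multilinear map. -/
noncomputable def tensorPairingMultilinear (b : V →ₗ[k] V →ₗ[k] k) (n : ℕ) :
    MultilinearMap k (fun _ : Fin n => V) ((⨂[k]^n V) →ₗ[k] k) :=
  MultilinearMap.mk' (tensorPairing b)
    (by
      intro y i z z'
      ext x
      have key : ∀ z, (fun j => b (x j) (Function.update y i z j)) =
          Function.update (fun j => b (x j) (y j)) i (b (x i) z) := by
        intro z
        funext j
        by_cases h : j = i
        · subst h; simp
        · simp [h]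
      have := (MultilinearMap.mkPiAlgebra k (Fin n) k).map_update_add
        (fun j => b (x j) (y j)) i (b (x i) z) (b (x i) z')
      simp only [LinearMap.compMultilinearMap_apply, LinearMap.add_apply, tensorPairing_tprod, key,
        map_add]
      exact this)
    (by
      intro y i c z
      ext x
      have key : ∀ z, (fun j => b (x j) (Function.update y i z j)) =
          Function.update (fun j => b (x j) (y j)) i (b (x i) z) := by
        intro z
        funext j
        by_cases h : j = i
        · subst h; simp
        · simp [h]
      have := (MultilinearMap.mkPiAlgebra k (Fin n) k).map_update_smul
        (fun j => b (x j) (y j)) i c (b (x i) z)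
      simpa [key] using this)

namespace RibbonGraph

variable {p q : ℕ}

instance (G : RibbonGraph p q) : Finite G.Vert := G.finite_vert
instance (G : RibbonGraph p q) : Finite G.Half := G.finite_half
instance (G : RibbonGraph p q) : Finite G.Edge := G.finite_edge
noncomputable instance (G : RibbonGraph p q) : Fintype G.Vert := Fintype.ofFinite _
noncomputable instance (G : RibbonGraph p q) : Fintype G.Half := Fintype.ofFinite _
noncomputable instance (G : RibbonGraph p q) : Fintype G.Edge := Fintype.ofFinite _
noncomputable instance (G : RibbonGraph p q) : DecidableEq G.Edge := Classical.decEq _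

variable (C : CyclicAlgebra k V) (G : RibbonGraph p q)

/-- The number of half-edges at a vertex. -/
noncomputable def valence (v : G.Vert) : ℕ :=
  (IsCyclicNumbering.exists_of_sameCycle G.sameCycle_iff v).choose

/-- A cyclic numbering of the half-edges at a vertex. -/
noncomputable def numbering (v : G.Vert) : Fin (G.valence v) → G.Half :=
  (IsCyclicNumbering.exists_of_sameCycle G.sameCycle_iff v).choose_spec.choose

theorem isCyclicNumbering_numbering (v : G.Vert) :
    IsCyclicNumbering G.next G.vert v (G.numbering v) :=
  (IsCyclicNumbering.exists_of_sameCycle G.sameCycle_iff v).choose_spec.choose_spec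

/-- The value of the cyclic tensor at a vertex on vectors attached to the half-edges. -/
noncomputable def vertexWeight (v : G.Vert) (w : G.Half → V) : k :=
  C.T (G.valence v) (PiTensorProduct.tprod k (w ∘ G.numbering v))

variable {G} in
theorem vertexWeight_eq {v : G.Vert} {r : ℕ} {ν : Fin r → G.Half}
    (h : IsCyclicNumbering G.next G.vert v ν) (w : G.Half → V) :
    G.vertexWeight C v w = C.T r (PiTensorProduct.tprod k (w ∘ ν)) :=
  C.T_eq_of_isCyclicNumbering (G.isCyclicNumbering_numbering v) h w

theorem vertexWeight_map {p' q' : ℕ} {G' : RibbonGraph p' q'} (f : G.Half → G'.Half)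
    (hf : Function.Injective f) {v : G.Vert} {v' : G'.Vert}
    (hnext : ∀ x, G'.next (f x) = f (G.next x))
    (hvert : ∀ y, G'.vert y = v' ↔ ∃ x, G.vert x = v ∧ f x = y) (w : G'.Half → V) :
    G'.vertexWeight C v' w = G.vertexWeight C v (w ∘ f) :=
  vertexWeight_eq C ((G.isCyclicNumbering_numbering v).map f hf hnext hvert) w

/-- The vector at `h` enters only the factor of the vertex of `h`, and there in a single slot, since
the numbering is injective. -/
theorem exists_vertexWeight_linear [DecidableEq G.Half] (w : G.Half → V) (h : G.Half) :
    ∃ L : V →ₗ[k] k, ∀ z, ∏ v, G.vertexWeight C v (Function.update w h z) = L z := by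
  classical
  obtain ⟨i, hi⟩ := ((G.isCyclicNumbering_numbering (G.vert h)).vert_eq_iff h).1 rfl
  refine ⟨(∏ v ∈ Finset.univ.erase (G.vert h), G.vertexWeight C v w) •
    (C.T _ ∘ₗ (PiTensorProduct.tprod k).toLinearMap (w ∘ G.numbering (G.vert h)) i),
    fun z => ?_⟩
  rw [← Finset.prod_erase_mul _ _ (Finset.mem_univ (G.vert h))]
  have h1 : ∀ v ∈ Finset.univ.erase (G.vert h),
      G.vertexWeight C v (Function.update w h z) = G.vertexWeight C v w := by
    intro v hv
    unfold vertexWeight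
    congr 2
    funext j
    refine Function.update_of_ne ?_ _ _
    rintro rfl
    exact (Finset.mem_erase.1 hv).1
      (((G.isCyclicNumbering_numbering v).vert_eq_iff _).2 ⟨j, rfl⟩).symm
  have h2 : G.vertexWeight C (G.vert h) (Function.update w h z) =
      C.T _ (PiTensorProduct.tprod k
        (Function.update (w ∘ G.numbering (G.vert h)) i z)) := by
    unfold vertexWeight
    congr 2
    funext j
    by_cases hj : j = i
    · subst hj
      simp [hi]
    · rw [Function.update_of_ne hj, Function.comp_apply, Function.comp_apply,
        Function.update_of_ne]
      intro hh
      exact hj ((G.isCyclicNumbering_numbering _).injective (hh.trans hi.symm))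
  rw [Finset.prod_congr rfl h1, h2]
  rfl

/-- The operator obtained by attaching vectors to the ends of a ribbon graph: the cyclic tensors are
evaluated at the vertices, the incoming endpoints are paired with the arguments, and the outgoing
endpoints give the value. -/
noncomputable def contraction :
    MultilinearMap k (fun _ : G.Half ⊕ (Fin p ⊕ Fin q) => V) (EndProp k V p q) := by
  classical
  let F : (G.Half ⊕ (Fin p ⊕ Fin q) → V) → EndProp k V p q := fun w =>
    (∏ v, G.vertexWeight C v (w ∘ Sum.inl)) •
      (tensorPairing C.b (w ∘ Sum.inr ∘ Sum.inl)).smulRight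
        (PiTensorProduct.tprod k (w ∘ Sum.inr ∘ Sum.inr))
  -- Multilinearity is linearity in each end separately; the three kinds of end enter the cyclic
  -- tensors, the input pairing and the output tensor respectively.
  have key : ∀ (w : G.Half ⊕ (Fin p ⊕ Fin q) → V) (x : G.Half ⊕ (Fin p ⊕ Fin q)),
      ∃ L : V →ₗ[k] EndProp k V p q, ∀ z, F (Function.update w x z) = L z := by
    rintro w (h | (i | j))
    · obtain ⟨L, hL⟩ := G.exists_vertexWeight_linear C (w ∘ Sum.inl) h
      refine ⟨L.smulRight ((tensorPairing C.b (w ∘ Sum.inr ∘ Sum.inl)).smulRight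
        (PiTensorProduct.tprod k (w ∘ Sum.inr ∘ Sum.inr))), fun z => ?_⟩
      simp only [F, LinearMap.smulRight_apply, ← hL]
      congr 1
      simp [Sum.update_inl_comp_inl]
    · refine ⟨(∏ v, G.vertexWeight C v (w ∘ Sum.inl)) •
        (LinearMap.smulRightₗ.flip (PiTensorProduct.tprod k (w ∘ Sum.inr ∘ Sum.inr))) ∘ₗ
        (tensorPairingMultilinear C.b p).toLinearMap (w ∘ Sum.inr ∘ Sum.inl) i, fun z => ?_⟩
      have h1 : Function.update w (Sum.inr (Sum.inl i)) z ∘ Sum.inr ∘ Sum.inl =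
          Function.update (w ∘ Sum.inr ∘ Sum.inl) i z :=
        Function.update_comp_eq_of_injective w
          (Sum.inr_injective.comp Sum.inl_injective) i z
      have h2 : Function.update w (Sum.inr (Sum.inl i)) z ∘ Sum.inr ∘ Sum.inr =
          w ∘ Sum.inr ∘ Sum.inr := by
        funext j
        simp
      have h3 : Function.update w (Sum.inr (Sum.inl i)) z ∘ Sum.inl = w ∘ Sum.inl := by
        funext j
        simp
      simp only [F, h1, h2, h3]
      rfl
    · refine ⟨(∏ v, G.vertexWeight C v (w ∘ Sum.inl)) •
        (LinearMap.smulRightₗ (tensorPairing C.b (w ∘ Sum.inr ∘ Sum.inl))) ∘ₗ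
        (PiTensorProduct.tprod k).toLinearMap (w ∘ Sum.inr ∘ Sum.inr) j, fun z => ?_⟩
      have h1 : Function.update w (Sum.inr (Sum.inr j)) z ∘ Sum.inr ∘ Sum.inr =
          Function.update (w ∘ Sum.inr ∘ Sum.inr) j z :=
        Function.update_comp_eq_of_injective w
          (Sum.inr_injective.comp Sum.inr_injective) j z
      have h2 : Function.update w (Sum.inr (Sum.inr j)) z ∘ Sum.inr ∘ Sum.inl =
          w ∘ Sum.inr ∘ Sum.inl := by
        funext j
        simp
      have h3 : Function.update w (Sum.inr (Sum.inr j)) z ∘ Sum.inl = w ∘ Sum.inl := by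
        funext j
        simp
      simp only [F, h1, h2, h3]
      rfl
  exact MultilinearMap.mk' F
    (fun w x z z' => by
      obtain ⟨L, hL⟩ := key w x
      simp only [hL, map_add])
    (fun w x c z => by
      obtain ⟨L, hL⟩ := key w x
      simp only [hL, map_smul])

theorem contraction_apply (w : G.Half ⊕ (Fin p ⊕ Fin q) → V) :
    G.contraction C w = (∏ v, G.vertexWeight C v (w ∘ Sum.inl)) •
      (tensorPairing C.b (w ∘ Sum.inr ∘ Sum.inl)).smulRight
        (PiTensorProduct.tprod k (w ∘ Sum.inr ∘ Sum.inr)) := rfl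

end RibbonGraph

end Contraction

/-! ## The state sum of a ribbon graph -/

namespace RibbonGraph

variable {k : Type u} [Field k] {V : Type v} [AddCommGroup V] [Module k V]
variable {C : CyclicAlgebra k V} {I : Type} [Fintype I] [DecidableEq I] (D : DualFrame C.b I)
variable {p q : ℕ}

/-- The state sum of a ribbon graph whose edges are oriented by `σ`: the edges are coloured by
the index set of a pair of dual bases. -/
noncomputable def orientedSum (G : RibbonGraph p q) (σ : G.Half ⊕ (Fin p ⊕ Fin q) → Bool) :
    EndProp k V p q :=
  ∑ d : G.Edge → I, G.contraction C fun x => D.vec (σ x) (d (G.edge x))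

/-- The state sum of a ribbon graph. -/
noncomputable def stateSum (G : RibbonGraph p q) : EndProp k V p q :=
  G.orientedSum D (exists_isOrientation G.other_end).choose

/-- Frees each computation to use whichever orientation suits it. -/
theorem stateSum_eq (G : RibbonGraph p q) {σ : G.Half ⊕ (Fin p ⊕ Fin q) → Bool}
    (hσ : IsOrientation G.edge σ) : G.stateSum D = G.orientedSum D σ := by
  exact sum_multilinear_eq_of_isOrientation C.symm D G.other_end _
    (exists_isOrientation G.other_end).choose_spec hσ

theorem Iso.isOrientation {G G' : RibbonGraph p q} (e : Iso G G')
    {σ : G'.Half ⊕ (Fin p ⊕ Fin q) → Bool} (hσ : IsOrientation G'.edge σ) :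
    IsOrientation G.edge (σ ∘ Sum.map e.onHalf id) := by
  intro x y hxy h
  refine hσ _ _ (fun hh => hxy ?_) (by rw [e.edge_eq, e.edge_eq, h])
  exact Sum.map_injective.2 ⟨e.onHalf.injective, Function.injective_id⟩ hh

/-- Pull the orientation back and reindex colourings and vertices. The chosen numberings of
corresponding vertices need not correspond; `vertexWeight_map` absorbs the discrepancy through
cyclic invariance. -/
theorem Iso.stateSum_eq {G G' : RibbonGraph p q} (e : Iso G G') :
    G.stateSum D = G'.stateSum D := by
  obtain ⟨σ, hσ⟩ := exists_isOrientation G'.other_end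
  rw [G'.stateSum_eq D hσ, G.stateSum_eq D (e.isOrientation hσ)]
  refine Fintype.sum_equiv (e.onEdge.arrowCongr (Equiv.refl I)) _ _ fun d => ?_
  rw [contraction_apply, contraction_apply]
  congr 1
  · refine Fintype.prod_equiv e.onVert _ _ fun v => ?_
    refine (Eq.trans (G.vertexWeight_map C (v := v) e.onHalf
      e.onHalf.injective e.next_eq ?_ _) ?_).symm
    · intro y
      constructor
      · intro hy
        refine ⟨e.onHalf.symm y, e.onVert.injective ?_, by simp⟩
        rw [← e.vert_eq, Equiv.apply_symm_apply, hy]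
      · rintro ⟨x, rfl, rfl⟩
        exact e.vert_eq x
    · congr 1
      funext h
      have := e.edge_eq (Sum.inl h)
      simp only [Sum.map_inl] at this
      simp [this]
  · have h1 : ∀ x, G'.edge (Sum.inr x) = e.onEdge (G.edge (Sum.inr x)) :=
      fun x => e.edge_eq (Sum.inr x)
    refine congrArg₂ (fun a c => (tensorPairing C.b a).smulRight (PiTensorProduct.tprod k c))
      (funext fun x => ?_) (funext fun x => ?_) <;> simp [h1]

theorem orientedSum_apply_tprod (G : RibbonGraph p q) (σ : G.Half ⊕ (Fin p ⊕ Fin q) → Bool)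
    (x : Fin p → V) :
    G.orientedSum D σ (PiTensorProduct.tprod k x) = ∑ d : G.Edge → I,
      ((∏ v, G.vertexWeight C v fun h => D.vec (σ (Sum.inl h)) (d (G.edge (Sum.inl h)))) *
        ∏ i, C.b (x i)
          (D.vec (σ (Sum.inr (Sum.inl i))) (d (G.edge (Sum.inr (Sum.inl i)))))) •
        PiTensorProduct.tprod k fun j =>
          D.vec (σ (Sum.inr (Sum.inr j))) (d (G.edge (Sum.inr (Sum.inr j)))) := by
  simp only [orientedSum, LinearMap.sum_apply, contraction_apply, LinearMap.smul_apply,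
    LinearMap.smulRight_apply, tensorPairing_tprod, smul_smul]
  rfl

/-! ### Elementary graphs -/

/-- The expansion of a pure tensor in the frame. -/
theorem _root_.DualFrame.sum_smul_tprod {b : V →ₗ[k] V →ₗ[k] k} (D : DualFrame b I) (s : Bool)
    {n : ℕ} (x : Fin n → V) :
    ∑ d : Fin n → I, (∏ i, b (x i) (D.vec (!s) (d i))) •
      PiTensorProduct.tprod k (fun i => D.vec s (d i)) = PiTensorProduct.tprod k x := by
  conv_rhs => rw [← funext fun i => D.expand s (x i)]
  rw [MultilinearMap.map_sum]
  exact Finset.sum_congr rfl fun d _ => (MultilinearMap.map_smul_univ _ _ _).symm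

/-- With sign `false` at inputs and `true` at outputs, the state sum is the frame expansion of the
permuted pure tensor. -/
theorem stateSum_wiring_equiv {E : Type} (hE : Finite E) (f : Fin p ≃ E) (g : Fin q ≃ E)
    (x : Fin p → V) :
    (wiring E hE (Sum.elim f g) (existsUnique_other_of_equiv f g)).stateSum D
      (PiTensorProduct.tprod k x) = PiTensorProduct.tprod k (x ∘ f.symm ∘ g) := by
  rw [stateSum_eq D (σ := Sum.elim Empty.elim (Sum.elim (fun _ => false) (fun _ => true)))]
  · rw [orientedSum_apply_tprod, ← D.sum_smul_tprod true]
    refine Fintype.sum_equiv (show ((wiring E hE (Sum.elim f g)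
      (existsUnique_other_of_equiv f g)).Edge → I) ≃ (Fin q → I) from
      g.symm.arrowCongr (Equiv.refl I)) _ _ fun d => ?_
    have : IsEmpty (wiring E hE (Sum.elim f g) (existsUnique_other_of_equiv f g)).Vert :=
      inferInstanceAs (IsEmpty Empty)
    rw [Finset.prod_of_isEmpty, one_mul]
    congr 1
    refine Fintype.prod_equiv (f.trans g.symm) _ _ fun i => ?_
    have hx : (x ∘ f.symm ∘ g) ((f.trans g.symm) i) = x i := by simp
    rw [hx]
    change _ = C.b (x i) (D.vec false (d (g (g.symm (f i)))))
    rw [Equiv.apply_symm_apply]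
    rfl
  · rintro (x | (x | x)) (y | (y | y)) hxy h
    · exact x.elim
    · exact x.elim
    · exact x.elim
    · exact y.elim
    · exact absurd (congrArg _ (congrArg _ (f.injective h))) hxy
    · rfl
    · exact y.elim
    · rfl
    · exact absurd (congrArg _ (congrArg _ (g.injective h))) hxy

theorem stateSum_strands (n : ℕ) : (strands n).stateSum D = LinearMap.id := by
  ext x
  exact stateSum_wiring_equiv D _ (Equiv.refl (Fin n)) (Equiv.refl _) x

theorem stateSum_arc (x y : V) :
    EndProp.scalar k V (arc.stateSum D (PiTensorProduct.tprod k ![x, y])) = C.b x y := by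
  -- The two inputs must get opposite signs; after one use of symmetry the sum is `parseval`.
  rw [stateSum_eq D (σ := Sum.elim Empty.elim (Sum.elim (fun i => decide (i = 0)) Fin.elim0))]
  · rw [orientedSum_apply_tprod, ← D.parseval false x y]
    have : IsEmpty arc.Vert := inferInstanceAs (IsEmpty Empty)
    rw [map_sum]
    refine Fintype.sum_equiv (show (arc.Edge → I) ≃ I from Equiv.funUnique Unit I) _ _ fun d => ?_
    rw [Finset.prod_of_isEmpty, one_mul, map_smul]
    simp only [EndProp.scalar, arc, wiring, Fin.prod_univ_two, PiTensorProduct.isEmptyEquiv_apply_tprod]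
    simp [C.symm y]
    rfl
  · rintro (x | (x | x)) (y | (y | y)) hxy h
    · exact x.elim
    · exact x.elim
    · exact x.elim
    · exact y.elim
    · fin_cases x <;> fin_cases y <;> first | exact absurd rfl hxy | rfl
    · exact y.elim0
    · exact y.elim
    · exact x.elim0
    · exact x.elim0

theorem isCyclicNumbering_corolla (r : ℕ) :
    IsCyclicNumbering (corolla r).next (corolla r).vert () (id : Fin r → Fin r) where
  injective := Function.injective_id
  vert_eq_iff h := ⟨fun _ => ⟨h, rfl⟩, fun _ => rfl⟩
  next_eq _ := rfl

theorem stateSum_corolla (r : ℕ) (t : ⨂[k]^r V) :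
    EndProp.scalar k V ((corolla r).stateSum D t) = C.T r t := by
  suffices h : (EndProp.scalar k V).toLinearMap ∘ₗ (corolla r).stateSum D = C.T r from
    LinearMap.congr_fun h t
  ext x
  change EndProp.scalar k V ((corolla r).stateSum D (PiTensorProduct.tprod k x)) = C.T r _
  -- Inputs are paired with `D.vec false` and the vertex receives `D.vec true`, so the state sum is
  -- `T r` applied to the frame expansion of the argument.
  rw [stateSum_eq D (σ := Sum.elim (fun _ => true) (Sum.elim (fun _ => false) Fin.elim0))]
  · rw [orientedSum_apply_tprod, ← D.sum_smul_tprod true x, map_sum, map_sum]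
    refine Fintype.sum_equiv (show ((corolla r).Edge → I) ≃ (Fin r → I) from
      Equiv.refl _) _ _ fun d => ?_
    have : Unique (corolla r).Vert := inferInstanceAs (Unique Unit)
    rw [map_smul, map_smul, Fintype.prod_unique,
      vertexWeight_eq C (v := (default : (corolla r).Vert)) (isCyclicNumbering_corolla r)]
    simp only [EndProp.scalar, PiTensorProduct.isEmptyEquiv_apply_tprod, smul_eq_mul, mul_one]
    rw [mul_comm]
    rfl
  · rintro (x | (x | x)) (y | (y | y)) hxy h
    · exact absurd (congrArg _ h) hxy
    · rfl
    · exact y.elim0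
    · rfl
    · exact absurd (congrArg _ (congrArg _ h)) hxy
    · exact y.elim0
    · exact x.elim0
    · exact x.elim0
    · exact x.elim0

end RibbonGraph

/-! ## Functoriality of the state sum -/

theorem TensorPower.mulEquiv_tprod {k : Type u} [Field k] {V : Type v} [AddCommGroup V]
    [Module k V] {m n : ℕ} (x : Fin m → V) (y : Fin n → V) :
    TensorPower.mulEquiv (PiTensorProduct.tprod k x ⊗ₜ[k] PiTensorProduct.tprod k y) =
      PiTensorProduct.tprod k (Fin.append x y) :=
  TensorPower.tprod_mul_tprod k x y

namespace EndProp

variable {k : Type u} [Field k] {V : Type v} [AddCommGroup V] [Module k V]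

theorem mulEquiv_symm_tprod {m n : ℕ} (x : Fin (m + n) → V) :
    TensorPower.mulEquiv.symm (PiTensorProduct.tprod k x) =
      PiTensorProduct.tprod k (fun i => x (Fin.castAdd n i)) ⊗ₜ[k]
        PiTensorProduct.tprod k (fun i => x (Fin.natAdd m i)) := by
  rw [LinearEquiv.symm_apply_eq, TensorPower.mulEquiv_tprod]
  congr 1
  funext i
  induction i using Fin.addCases <;> simp

theorem tensor_tprod {p q p' q' : ℕ} (f : EndProp k V p q) (g : EndProp k V p' q')
    (x : Fin (p + p') → V) :
    EndProp.tensor f g (PiTensorProduct.tprod k x) =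
      TensorPower.mulEquiv (f (PiTensorProduct.tprod k fun i => x (Fin.castAdd p' i)) ⊗ₜ[k]
        g (PiTensorProduct.tprod k fun i => x (Fin.natAdd p i))) := by
  simp only [EndProp.tensor, LinearMap.comp_apply, LinearEquiv.coe_coe, mulEquiv_symm_tprod,
    TensorProduct.map_tmul]

theorem braiding_tprod {m n : ℕ} (x : Fin (m + n) → V) :
    EndProp.braiding k V m n (PiTensorProduct.tprod k x) =
      PiTensorProduct.tprod k (x ∘ finAddFlip) := by
  simp only [EndProp.braiding, LinearMap.comp_apply, LinearEquiv.coe_coe, mulEquiv_symm_tprod,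
    TensorProduct.comm_tmul, TensorPower.mulEquiv_tprod]
  congr 1
  funext i
  induction i using Fin.addCases <;> simp

end EndProp

/-! ### Orientations and colourings of composites and juxtapositions -/

namespace RibbonGraph

/-- Ends that are glued can be given opposite signs. -/
theorem exists_isOrientation_glue {E A ι : Type} {f : E → A} {s t : ι → E}
    (hf : ∀ x, ∃! y, y ≠ x ∧ f y = f x)
    (hs : Function.Injective s) (ht : Function.Injective t) (hst : ∀ i j, s i ≠ t j)
    {S : Set ι} (hS : S.Finite) :
    ∃ τ, IsOrientation f τ ∧ (∀ i ∈ S, τ (t i) = !τ (s i)) ∧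
      ∀ x y, (∀ i ∈ S, x ≠ s i ∧ x ≠ t i) → (∀ i ∈ S, y ≠ s i ∧ y ≠ t i) → x ≠ y →
        Relation.EqvGen (GlueRel f s t S) (f x) (f y) → τ y = !τ x := by
  classical
  induction S, hS using Set.Finite.induction_on with
  | empty =>
    obtain ⟨τ, hτ⟩ := exists_isOrientation hf
    refine ⟨τ, hτ, fun i hi => hi.elim, fun x y _ _ hxy h => hτ x y hxy ?_⟩
    have key : ∀ a b, Relation.EqvGen (GlueRel f s t ∅) a b → a = b := by
      intro a b h
      induction h with
      | rel x y h =>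
        obtain ⟨i, hi, _⟩ := h
        exact hi.elim
      | refl x => rfl
      | symm x y _ ih => exact ih.symm
      | trans x y z _ _ ih1 ih2 => exact ih1.trans ih2
    exact key _ _ h
  | @insert j S hj _ ih =>
    have hsl : ∀ i ∈ S, s j ≠ s i ∧ s j ≠ t i := fun i hi =>
      ⟨fun h => hj (hs h ▸ hi), hst j i⟩
    have htl : ∀ i ∈ S, t j ≠ s i ∧ t j ≠ t i := fun i hi =>
      ⟨(hst i j).symm, fun h => hj (ht h ▸ hi)⟩
    -- It suffices to arrange that the ends `s j`, `t j` about to be glued have opposite signs.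
    have good : ∃ τ, IsOrientation f τ ∧ (∀ i ∈ S, τ (t i) = !τ (s i)) ∧
        (∀ x y, (∀ i ∈ S, x ≠ s i ∧ x ≠ t i) → (∀ i ∈ S, y ≠ s i ∧ y ≠ t i) → x ≠ y →
          Relation.EqvGen (GlueRel f s t S) (f x) (f y) → τ y = !τ x) ∧
        τ (t j) = !τ (s j) := by
      obtain ⟨τ, h1, h2, h3⟩ := ih
      by_cases hτ : τ (t j) = !τ (s j)
      · exact ⟨τ, h1, h2, h3, hτ⟩
      -- If they agree, all signs in the class of `s j` are flipped. That class does not contain `t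
      -- j`: remaining ends of one class already have opposite signs.
      let R := Relation.EqvGen (GlueRel f s t S)
      have hR : ∀ a b, R a b → (R a (f (s j)) ↔ R b (f (s j))) := fun a b h =>
        ⟨fun h' => (h.symm).trans _ _ _ h', fun h' => h.trans _ _ _ h'⟩
      have hflip : ∀ x y, R (f x) (f y) → τ y = !τ x →
          (if R (f y) (f (s j)) then !τ y else τ y) =
            !(if R (f x) (f (s j)) then !τ x else τ x) := by
        intro x y hxy h
        simp only [hR _ _ hxy, h]
        split_ifs <;> rfl
      refine ⟨fun x => if R (f x) (f (s j)) then !τ x else τ x, fun x y hxy h => ?_,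
        fun i hi => ?_, fun x y hx hy hxy h => ?_, ?_⟩
      · exact hflip x y (h ▸ Relation.EqvGen.refl _) (h1 x y hxy h)
      · exact hflip _ _ (Relation.EqvGen.rel _ _ ⟨i, hi, rfl, rfl⟩) (h2 i hi)
      · exact hflip x y h (h3 x y hx hy hxy h)
      · have hn : ¬ R (f (t j)) (f (s j)) := fun h => hτ (h3 _ _ hsl htl (hst j j) h.symm)
        beta_reduce
        rw [if_neg hn, if_pos (Relation.EqvGen.refl _)]
        simpa using hτ
    obtain ⟨τ, h1, h2, h3, h4⟩ := good
    refine ⟨τ, h1, ?_, ?_⟩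
    · rintro i (rfl | hi)
      · exact h4
      · exact h2 i hi
    · intro x y hx hy hxy h
      have hx' : ∀ i ∈ S, x ≠ s i ∧ x ≠ t i := fun i hi => hx i (Set.mem_insert_of_mem _ hi)
      have hy' : ∀ i ∈ S, y ≠ s i ∧ y ≠ t i := fun i hi => hy i (Set.mem_insert_of_mem _ hi)
      have hxj := hx j (Set.mem_insert _ _)
      have hyj := hy j (Set.mem_insert _ _)
      -- Either `x` and `y` were joined already, or one was joined to `s j` and the other to `t j`;
      -- in the latter case three sign changes along the path leave `x` and `y` opposite.
      rcases eqvGen_glueRel_insert h with h | ⟨hx'', hy''⟩ | ⟨hx'', hy''⟩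
      · exact h3 x y hx' hy' hxy h
      · have e1 := h3 _ _ hx' hsl hxj.1 hx''
        have e2 := h3 _ _ hy' htl hyj.2 hy''
        rw [h4, e1] at e2
        simpa using e2.symm
      · have e1 := h3 _ _ hx' htl hxj.2 hx''
        have e2 := h3 _ _ hy' hsl hyj.1 hy''
        rw [e2] at h4
        rw [h4] at e1
        simpa using e1

variable {p q r p' q' : ℕ}

theorem compEnds_injective (H H' : Type) :
    Function.Injective (compEnds (p := p) (q := q) (r := r) H H') := by
  rintro ((y | y) | (y | y)) ((z | z) | (z | z)) h <;> simp_all [compEnds]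

/-- The ends of a composite can be oriented compatibly with orientations of the two graphs that are
opposite at the glued endpoints. -/
theorem exists_isOrientation_comp (G : RibbonGraph q r) (K : RibbonGraph p q) :
    ∃ (σ : G.Half ⊕ (Fin q ⊕ Fin r) → Bool) (τ : K.Half ⊕ (Fin p ⊕ Fin q) → Bool),
      IsOrientation G.edge σ ∧ IsOrientation K.edge τ ∧
      (∀ i, σ (Sum.inr (Sum.inl i)) = !τ (Sum.inr (Sum.inr i))) ∧
      IsOrientation (G.comp K).edge (Sum.elim σ τ ∘ compEnds G.Half K.Half) := by
  obtain ⟨τ, h1, h2, h3⟩ := exists_isOrientation_glue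
      (s := fun i : Fin q => (Sum.inl (Sum.inr (Sum.inl i)) :
        (G.Half ⊕ (Fin q ⊕ Fin r)) ⊕ (K.Half ⊕ (Fin p ⊕ Fin q))))
      (t := fun i : Fin q => Sum.inr (Sum.inr (Sum.inr i)))
      (existsUnique_other_sum G.other_end K.other_end)
      (fun i j h => by simpa using h) (fun i j h => by simpa using h) (fun i j => by simp)
      (Set.finite_univ (α := Fin q))
  have hrel : GlueRel (Sum.map G.edge K.edge)
      (fun i : Fin q => (Sum.inl (Sum.inr (Sum.inl i)) :
        (G.Half ⊕ (Fin q ⊕ Fin r)) ⊕ (K.Half ⊕ (Fin p ⊕ Fin q))))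
      (fun i : Fin q => Sum.inr (Sum.inr (Sum.inr i))) Set.univ = CompRel G K := by
    funext a b
    simp [GlueRel, CompRel]
  rw [hrel] at h3
  have hlive : ∀ z : (G.Half ⊕ K.Half) ⊕ (Fin p ⊕ Fin r), ∀ i ∈ (Set.univ : Set (Fin q)),
      compEnds G.Half K.Half z ≠ Sum.inl (Sum.inr (Sum.inl i)) ∧
      compEnds G.Half K.Half z ≠ Sum.inr (Sum.inr (Sum.inr i)) := by
    rintro ((z | z) | (z | z)) i - <;> simp [compEnds]
  refine ⟨τ ∘ Sum.inl, τ ∘ Sum.inr, fun x y hxy h => ?_, fun x y hxy h => ?_, fun i => ?_, ?_⟩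
  · exact h1 _ _ (fun hh => hxy (Sum.inl_injective hh)) (congrArg Sum.inl h)
  · exact h1 _ _ (fun hh => hxy (Sum.inr_injective hh)) (congrArg Sum.inr h)
  · simp [h2 i trivial]
  · rw [Sum.elim_comp_inl_inr]
    intro x y hxy h
    exact h3 _ _ (hlive x) (hlive y) (fun hh => hxy (compEnds_injective _ _ hh)) (Quot.eqvGen_exact h)

theorem isOrientation_juxt (G : RibbonGraph p q) (K : RibbonGraph p' q')
    {σ : G.Half ⊕ (Fin p ⊕ Fin q) → Bool} {τ : K.Half ⊕ (Fin p' ⊕ Fin q') → Bool}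
    (hσ : IsOrientation G.edge σ) (hτ : IsOrientation K.edge τ) :
    IsOrientation (G.juxt K).edge (Sum.elim σ τ ∘ juxtEnds G.Half K.Half) := by
  intro x y hxy h
  replace hxy := fun hh => hxy ((juxtEnds G.Half K.Half).injective hh)
  change Sum.map G.edge K.edge (juxtEnds G.Half K.Half x) =
    Sum.map G.edge K.edge (juxtEnds G.Half K.Half y) at h
  change Sum.elim σ τ (juxtEnds G.Half K.Half y) = !Sum.elim σ τ (juxtEnds G.Half K.Half x)
  generalize juxtEnds G.Half K.Half x = x' at *
  generalize juxtEnds G.Half K.Half y = y' at *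
  rcases x' with x' | x' <;> rcases y' with y' | y'
  · exact hσ _ _ (fun hh => hxy (congrArg _ hh)) (Sum.inl_injective h)
  · simp at h
  · simp at h
  · exact hτ _ _ (fun hh => hxy (congrArg _ hh)) (Sum.inr_injective h)

variable {k : Type u} [Field k] {V : Type v} [AddCommGroup V] [Module k V]
variable {C : CyclicAlgebra k V} {I : Type} [Fintype I] [DecidableEq I] (D : DualFrame C.b I)

/-- Common to juxtaposition and composition, neither of which alters the vertices or their cyclic
orders. -/
theorem prod_vertexWeight_sum {G : RibbonGraph p q} {K : RibbonGraph p' q'} {m n : ℕ}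
    {L : RibbonGraph m n} (eV : G.Vert ⊕ K.Vert ≃ L.Vert) (eH : G.Half ⊕ K.Half ≃ L.Half)
    (hnext : ∀ x, L.next (eH x) = eH (Sum.map G.next K.next x))
    (hvert : ∀ x, L.vert (eH x) = eV (Sum.map G.vert K.vert x)) (w : L.Half → V) :
    ∏ v, L.vertexWeight C v w = (∏ v, G.vertexWeight C v fun h => w (eH (Sum.inl h))) *
      ∏ v, K.vertexWeight C v fun h => w (eH (Sum.inr h)) := by
  rw [← eV.prod_comp, Fintype.prod_sum_type]
  congr 1
  · refine Finset.prod_congr rfl fun v _ => ?_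
    refine vertexWeight_map C G (eH ∘ Sum.inl) (eH.injective.comp Sum.inl_injective)
      (fun x => hnext (Sum.inl x)) (fun y => ?_) w
    obtain ⟨x | x, rfl⟩ := eH.surjective y <;> simp [hvert]
  · refine Finset.prod_congr rfl fun v _ => ?_
    refine vertexWeight_map C K (eH ∘ Sum.inr) (eH.injective.comp Sum.inr_injective)
      (fun x => hnext (Sum.inr x)) (fun y => ?_) w
    obtain ⟨x | x, rfl⟩ := eH.surjective y <;> simp [hvert]

theorem stateSum_crossing (m n : ℕ) : (crossing m n).stateSum D = EndProp.braiding k V m n := by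
  ext x
  simp only [LinearMap.compMultilinearMap_apply, EndProp.braiding_tprod]
  refine (stateSum_wiring_equiv D _ finSumFinEquiv.symm
    (finSumFinEquiv.symm.trans (Equiv.sumComm _ _)) x).trans ?_
  rfl

/-- A colouring of the disjoint union is a pair of colourings, and all weights multiply. -/
theorem stateSum_juxt (G : RibbonGraph p q) (K : RibbonGraph p' q') :
    (G.juxt K).stateSum D = EndProp.tensor (G.stateSum D) (K.stateSum D) := by
  obtain ⟨σ, hσ⟩ := exists_isOrientation G.other_end
  obtain ⟨τ, hτ⟩ := exists_isOrientation K.other_end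
  rw [G.stateSum_eq D hσ, K.stateSum_eq D hτ, stateSum_eq D _ (isOrientation_juxt G K hσ hτ)]
  ext x
  simp only [LinearMap.compMultilinearMap_apply, EndProp.tensor_tprod, orientedSum_apply_tprod,
    TensorProduct.sum_tmul, TensorProduct.tmul_sum, map_sum, TensorProduct.smul_tmul_smul,
    map_smul, TensorPower.mulEquiv_tprod]
  rw [Finset.sum_comm, ← Fintype.sum_prod_type']
  refine Fintype.sum_equiv (show ((G.juxt K).Edge → I) ≃ (G.Edge → I) × (K.Edge → I) from
      Equiv.sumArrowEquivProdArrow _ _ _) _ _ fun d => ?_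
  rw [prod_vertexWeight_sum (L := G.juxt K) (Equiv.refl _) (Equiv.refl _)
    (fun x => by rcases x with x | x <;> rfl) (fun x => by rcases x with x | x <;> rfl),
    Fin.prod_univ_add]
  congr 1
  · rw [mul_mul_mul_comm]
    congr 1 <;>
    · congr 1
      refine Finset.prod_congr rfl fun i _ => ?_
      simp [juxtEnds, juxt]
      rfl
  · congr 1
    funext j
    induction j using Fin.addCases <;>
    · simp [juxtEnds, juxt]
      rfl

/-- The composite of operators is a sum over pairs of colourings, weighted by the pairings of the
outputs of `K` with the inputs of `G`. Opposite signs at glued ends make these Kronecker deltas. -/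
theorem stateSum_comp (G : RibbonGraph q r) (K : RibbonGraph p q) :
    (G.comp K).stateSum D = G.stateSum D ∘ₗ K.stateSum D := by
  obtain ⟨σ, τ, hσ, hτ, hστ, h⟩ := exists_isOrientation_comp G K
  rw [G.stateSum_eq D hσ, K.stateSum_eq D hτ, stateSum_eq D _ h]
  ext x
  simp only [LinearMap.compMultilinearMap_apply, LinearMap.comp_apply, orientedSum_apply_tprod,
    map_sum, map_smul, Finset.smul_sum, smul_smul]
  rw [Finset.sum_comm, ← Fintype.sum_prod_type']
  -- Colourings of the composite are the pairs that agree at every glued point; all other pairs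
  -- contribute zero.
  refine Fintype.sum_of_injective
    (show ((G.comp K).Edge → I) → (G.Edge → I) × (K.Edge → I) from fun d =>
      (fun a => d (Quot.mk _ (Sum.inl a)), fun a => d (Quot.mk _ (Sum.inr a)))) ?_ _ _ ?_ ?_
  · intro d d' hd
    funext a
    induction a using Quot.ind with
    | _ a =>
      rcases a with a | a
      · exact congrFun (congrArg Prod.fst hd) a
      · exact congrFun (congrArg Prod.snd hd) a
  · rintro ⟨d, d'⟩ hd
    have hne : ∃ i, d' (K.edge (Sum.inr (Sum.inr i))) ≠ d (G.edge (Sum.inr (Sum.inl i))) := by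
      by_contra! hall
      refine hd ⟨Quot.lift (Sum.elim d d') ?_, rfl⟩
      rintro _ _ ⟨i, rfl, rfl⟩
      exact (hall i).symm
    obtain ⟨i, hi⟩ := hne
    have hz : ∏ i, C.b (D.vec (τ (Sum.inr (Sum.inr i))) (d' (K.edge (Sum.inr (Sum.inr i)))))
        (D.vec (σ (Sum.inr (Sum.inl i))) (d (G.edge (Sum.inr (Sum.inl i))))) = 0 := by
      refine Finset.prod_eq_zero (Finset.mem_univ i) ?_
      rw [hστ, D.pairing, if_neg hi]
    simp [hz]
  · intro d
    have hz : ∀ i, C.b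
        (D.vec (τ (Sum.inr (Sum.inr i))) (d (Quot.mk _ (Sum.inr (K.edge (Sum.inr (Sum.inr i)))))))
        (D.vec (σ (Sum.inr (Sum.inl i)))
          (d (Quot.mk _ (Sum.inl (G.edge (Sum.inr (Sum.inl i))))))) = 1 := by
      intro i
      rw [hστ, D.pairing, if_pos]
      exact congrArg d (Quot.sound ⟨i, rfl, rfl⟩).symm
    simp only [hz, Finset.prod_const_one, mul_one]
    rw [prod_vertexWeight_sum (L := G.comp K) (Equiv.refl _) (Equiv.refl _)
      (fun x => by rcases x with x | x <;> rfl) (fun x => by rcases x with x | x <;> rfl)]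
    congr 1
    rw [mul_comm (∏ v, vertexWeight C G v _), mul_right_comm]
    rfl

end RibbonGraph

/-! ## The algebra over the PROP of ribbon graphs attached to a cyclic algebra -/

section

variable {k : Type u} [Field k] {V : Type v} [AddCommGroup V] [Module k V]

theorem CyclicAlgebra.exists_dualFrame (C : CyclicAlgebra k V) :
    ∃ n : ℕ, Nonempty (DualFrame C.b (Fin n)) := by
  have := C.nondegenerate
  -- A space with a perfect pairing is reflexive, and over a field this forces finite dimension.
  have : Module.IsReflexive k V := Module.IsReflexive.of_isPerfPair C.b
  have : FiniteDimensional k V := inferInstance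
  let e := Module.finBasis k V
  have hnd : LinearMap.BilinForm.Nondegenerate C.b :=
    ⟨fun x hx => (LinearMap.IsPerfPair.bijective_left (p := C.b)).injective
        (by rw [map_zero]; exact LinearMap.ext hx),
     fun x hx => (LinearMap.IsPerfPair.bijective_left (p := C.b)).injective
        (by rw [map_zero]; exact LinearMap.ext fun y => (C.symm x y).trans (hx y))⟩
  let e' := LinearMap.BilinForm.dualBasis C.b hnd e
  have h1 : ∀ i j, C.b (e' i) (e j) = if i = j then 1 else 0 := fun i j => by
    rw [LinearMap.BilinForm.apply_dualBasis_left hnd e i j]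
    simp only [eq_comm]
  have h2 : ∀ i j, C.b (e i) (e' j) = if i = j then 1 else 0 := fun i j => by
    rw [C.symm, h1]
    simp only [eq_comm]
  refine ⟨_, ⟨⟨fun s => if s then e else e', ?_, ?_⟩⟩⟩
  · rintro (_ | _) i j
    · simpa using h1 i j
    · simpa using h2 i j
  -- Stated for any dual pair of bases, so that it serves both signs.
  · have key : ∀ (c c' : Module.Basis (Fin (Module.finrank k V)) k V),
        (∀ i j, C.b (c i) (c' j) = if i = j then 1 else 0) →
        ∀ x, ∑ i, C.b x (c' i) • c i = x := by
      intro c c' h x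
      conv_rhs => rw [← c.sum_repr x]
      refine Finset.sum_congr rfl fun i _ => ?_
      congr 1
      conv_lhs => rw [← c.sum_repr x]
      simp [-Module.Basis.sum_repr, h]
    rintro (_ | _) x
    · simpa using key e' e h1 x
    · simpa using key e e' h2 x

namespace RGAlgebra

variable {C : CyclicAlgebra k V} {I : Type} [Fintype I] [DecidableEq I] (D : DualFrame C.b I)

/-- The state sum of an isomorphism class of ribbon graphs. -/
noncomputable def stateSumClass {p q : ℕ} (G : RibbonClass p q) : EndProp k V p q :=
  Quotient.lift (fun G : RibbonGraph p q => G.stateSum D) 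
    (by rintro _ _ ⟨e⟩; exact e.stateSum_eq D) G

theorem linearCombination_of {p q : ℕ} (G : RibbonGraph p q) :
    Finsupp.linearCombination k (stateSumClass D) (RG.of k G) = G.stateSum D := by
  rw [RG.of, Finsupp.linearCombination_single, one_smul]
  rfl

/-- The algebra over the PROP of ribbon graphs given by the state sums of a cyclic algebra. -/
noncomputable def ofDualFrame : RGAlgebra k V where
  act := Finsupp.linearCombination k (stateSumClass D)
  act_strands n := by
    rw [linearCombination_of, RibbonGraph.stateSum_strands]
  act_crossing m n := by
    rw [linearCombination_of, RibbonGraph.stateSum_crossing]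
  act_comp x y := by
    induction x using Finsupp.induction_linear with
    | zero => simp
    | add x x' hx hx' => rw [map_add, LinearMap.add_apply, map_add, hx, hx', map_add,
        LinearMap.add_comp]
    | single G a =>
      induction y using Finsupp.induction_linear with
      | zero => simp
      | add y y' hy hy' => rw [map_add, map_add, hy, hy', map_add, LinearMap.comp_add]
      | single K c =>
        induction G using Quotient.ind with
        | _ G =>
        induction K using Quotient.ind with
        | _ K =>
        simp only [RG.comp, Finsupp.linearCombination_single, LinearMap.smul_apply,
          Finsupp.lmapDomain_apply, Finsupp.mapDomain_single, map_smul, LinearMap.smul_comp,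
          LinearMap.comp_smul]
        rw [smul_comm]
        congr 2
        exact G.stateSum_comp D K
  act_tensor x y := by
    have hadd : ∀ {p q p' q' : ℕ} (f f' : EndProp k V p q) (g : EndProp k V p' q'),
        EndProp.tensor (f + f') g = EndProp.tensor f g + EndProp.tensor f' g := fun f f' g => by
      simp only [EndProp.tensor, TensorProduct.map_add_left, LinearMap.add_comp,
        LinearMap.comp_add]
    have hadd' : ∀ {p q p' q' : ℕ} (f : EndProp k V p q) (g g' : EndProp k V p' q'),
        EndProp.tensor f (g + g') = EndProp.tensor f g + EndProp.tensor f g' := fun f g g' => by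
      simp only [EndProp.tensor, TensorProduct.map_add_right, LinearMap.add_comp,
        LinearMap.comp_add]
    have hsmul : ∀ {p q p' q' : ℕ} (a c : k) (f : EndProp k V p q) (g : EndProp k V p' q'),
        EndProp.tensor (a • f) (c • g) = a • c • EndProp.tensor f g := fun a c f g => by
      simp only [EndProp.tensor, TensorProduct.map_smul_left, TensorProduct.map_smul_right,
        LinearMap.smul_comp, LinearMap.comp_smul]
      rw [smul_comm]
    have hzero : ∀ {p q p' q' : ℕ} (f : EndProp k V p q),
        EndProp.tensor f (0 : EndProp k V p' q') = 0 := fun f => by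
      simp [EndProp.tensor]
    have hzero' : ∀ {p q p' q' : ℕ} (f : EndProp k V p' q'),
        EndProp.tensor (0 : EndProp k V p q) f = 0 := fun f => by
      simp [EndProp.tensor]
    induction x using Finsupp.induction_linear with
    | zero => simp [hzero']
    | add x x' hx hx' => rw [map_add, LinearMap.add_apply, map_add, hx, hx', map_add, hadd]
    | single G a =>
      induction y using Finsupp.induction_linear with
      | zero => simp [hzero]
      | add y y' hy hy' => rw [map_add, map_add, hy, hy', map_add, hadd']
      | single K c =>
        induction G using Quotient.ind with
        | _ G =>
        induction K using Quotient.ind with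
        | _ K =>
        simp only [RG.tensor, Finsupp.linearCombination_single, LinearMap.smul_apply,
          Finsupp.lmapDomain_apply, Finsupp.mapDomain_single, map_smul, hsmul]
        congr 2
        exact G.stateSum_juxt D K

theorem ofDualFrame_act_of {p q : ℕ} (G : RibbonGraph p q) :
    (ofDualFrame D).act (RG.of k G) = G.stateSum D :=
  linearCombination_of D G

end RGAlgebra

end

/-! ## Generation of ribbon graphs by elementary graphs -/

namespace RibbonGraph

variable {p q r p' q' : ℕ}

theorem existsUnique_other_comp_equiv {E E' A : Type} {f : E → A} (e : E' ≃ E)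
    (hf : ∀ x, ∃! y, y ≠ x ∧ f y = f x) (x : E') :
    ∃! y, y ≠ x ∧ f (e y) = f (e x) := by
  obtain ⟨y, hy, hu⟩ := hf (e x)
  refine ⟨e.symm y, ⟨fun h => hy.1 (by rw [← h, e.apply_symm_apply]), by simpa using hy.2⟩,
    fun z hz => ?_⟩
  rw [Equiv.eq_symm_apply]
  exact hu _ ⟨fun h => hz.1 (e.injective h), hz.2⟩

/-- Renumbering of the endpoints. -/
def relabel (G : RibbonGraph p q) (σ : Fin p' ≃ Fin p) (τ : Fin q' ≃ Fin q) :
    RibbonGraph p' q' where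
  Vert := G.Vert
  Half := G.Half
  Edge := G.Edge
  finite_vert := G.finite_vert
  finite_half := G.finite_half
  finite_edge := G.finite_edge
  vert := G.vert
  next := G.next
  sameCycle_iff := G.sameCycle_iff
  edge x := G.edge (Equiv.sumCongr (Equiv.refl _) (Equiv.sumCongr σ τ) x)
  other_end := existsUnique_other_comp_equiv _ G.other_end

/-- The graph of strands that connect the endpoints according to a bijection. -/
def permGraph {m n : ℕ} (σ : Fin m ≃ Fin n) : RibbonGraph m n :=
  wiring (Fin n) inferInstance (Sum.elim σ (Equiv.refl _)) (existsUnique_other_of_equiv _ _)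

/-- A single arc that joins two outgoing endpoints. -/
def coarc : RibbonGraph 0 2 :=
  wiring Unit inferInstance (fun _ => ()) (by
    rintro (x | x)
    · exact x.elim0
    · refine ⟨Sum.inr (1 - x), ⟨?_, rfl⟩, ?_⟩
      · fin_cases x <;> simp
      · rintro (y | y) hy
        · exact y.elim0
        · fin_cases x <;> fin_cases y <;> simp_all)

/-- The graphs generated by the elementary ones under composition and juxtaposition. -/
inductive Generated : ∀ {p q : ℕ}, RibbonGraph p q → Prop
  | iso {p q : ℕ} {G G' : RibbonGraph p q} (e : Nonempty (Iso G G')) (h : Generated G) :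
      Generated G'
  | strands (n : ℕ) : Generated (strands n)
  | crossing (m n : ℕ) : Generated (crossing m n)
  | arc : Generated arc
  | coarc : Generated coarc
  | corolla (r : ℕ) : Generated (corolla r)
  | comp {p q r : ℕ} {G : RibbonGraph q r} {K : RibbonGraph p q} (hG : Generated G)
      (hK : Generated K) : Generated (G.comp K)
  | juxt {p q p' q' : ℕ} {G : RibbonGraph p q} {K : RibbonGraph p' q'} (hG : Generated G)
      (hK : Generated K) : Generated (G.juxt K)

/-- A criterion for a graph to be a composite: its edges represent the classes of joined edges. -/
theorem nonempty_iso_comp {G : RibbonGraph q r} {K : RibbonGraph p q} {L : RibbonGraph p r}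
    (eV : G.Vert ⊕ K.Vert ≃ L.Vert) (eH : G.Half ⊕ K.Half ≃ L.Half)
    (F : G.Edge ⊕ K.Edge → L.Edge) (g : L.Edge → G.Edge ⊕ K.Edge)
    (hvert : ∀ x, L.vert (eH x) = eV (Sum.map G.vert K.vert x))
    (hnext : ∀ x, L.next (eH x) = eH (Sum.map G.next K.next x))
    (hF : ∀ i, F (Sum.inl (G.edge (Sum.inr (Sum.inl i)))) =
      F (Sum.inr (K.edge (Sum.inr (Sum.inr i)))))
    (hg : ∀ c, F (g c) = c)
    (hmk : ∀ a, Quot.mk (CompRel G K) a = Quot.mk (CompRel G K) (g (F a)))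
    (hedge : ∀ x, L.edge (Sum.map eH id x) =
      F (Sum.map G.edge K.edge (compEnds G.Half K.Half x))) :
    Nonempty (Iso (G.comp K) L) :=
  ⟨{ onVert := eV
     onHalf := eH
     onEdge :=
      { toFun := Quot.lift F (by rintro _ _ ⟨i, rfl, rfl⟩; exact hF i)
        invFun := fun c => Quot.mk _ (g c)
        left_inv := by rintro ⟨a⟩; exact (hmk a).symm
        right_inv := hg }
     vert_eq := hvert
     next_eq := hnext
     edge_eq := hedge }⟩

/-- Every strand is absorbed by the edge of `G` to which it is glued, so each class has a
representative in `G`. -/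
theorem nonempty_iso_comp_permGraph (G : RibbonGraph p q) (σ : Fin p' ≃ Fin p) :
    Nonempty (Iso (G.comp (permGraph σ)) (G.relabel σ (Equiv.refl _))) :=
  nonempty_iso_comp (L := G.relabel σ (Equiv.refl _)) (Equiv.sumEmpty G.Vert Empty)
    (Equiv.sumEmpty G.Half Empty)
    (Sum.elim id fun i : Fin p => G.edge (Sum.inr (Sum.inl i))) Sum.inl
    (by rintro (x | x); exacts [rfl, x.elim])
    (by rintro (x | x); exacts [rfl, x.elim])
    (fun i => rfl) (fun c => rfl)
    (by
      rintro (a | i)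
      · rfl
      · exact (Quot.sound ⟨i, rfl, rfl⟩).symm)
    (by rintro ((x | x) | (x | x)); exacts [rfl, x.elim, rfl, rfl])

theorem nonempty_iso_permGraph_comp (G : RibbonGraph p q) (τ : Fin q' ≃ Fin q) :
    Nonempty (Iso ((permGraph τ.symm).comp G) (G.relabel (Equiv.refl _) τ)) :=
  nonempty_iso_comp (L := G.relabel (Equiv.refl _) τ) (Equiv.emptySum Empty G.Vert)
    (Equiv.emptySum Empty G.Half)
    (Sum.elim (fun j : Fin q' => G.edge (Sum.inr (Sum.inr (τ j)))) id) Sum.inr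
    (by rintro (x | x); exacts [x.elim, rfl])
    (by rintro (x | x); exacts [x.elim, rfl])
    (fun i => congrArg (fun j => G.edge (Sum.inr (Sum.inr j))) (τ.apply_symm_apply i))
    (fun c => rfl)
    (by
      rintro (j | a)
      · exact Quot.sound ⟨τ j, congrArg Sum.inl (τ.symm_apply_apply j).symm, rfl⟩
      · rfl)
    (by rintro ((x | x) | (x | x)); exacts [x.elim, rfl, rfl, rfl])

theorem nonempty_iso_permGraph_trans {l m n : ℕ} (σ : Fin l ≃ Fin m) (τ : Fin m ≃ Fin n) :
    Nonempty (Iso ((permGraph τ).relabel σ (Equiv.refl _)) (permGraph (σ.trans τ))) :=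
  ⟨{ onVert := Equiv.refl _
     onHalf := Equiv.refl _
     onEdge := Equiv.refl _
     vert_eq := fun _ => rfl
     next_eq := fun _ => rfl
     edge_eq := by rintro (x | (x | x)); exacts [x.elim, rfl, rfl] }⟩

theorem nonempty_iso_crossing_permGraph (m n : ℕ) :
    Nonempty (Iso (crossing m n) (permGraph finAddFlip)) :=
  ⟨{ onVert := Equiv.refl _
     onHalf := Equiv.refl _
     onEdge := (Equiv.sumComm _ _).trans finSumFinEquiv
     vert_eq := fun _ => rfl
     next_eq := fun _ => rfl
     edge_eq := by
      rintro (x | (x | x))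
      · exact x.elim
      · rfl
      · change x = finSumFinEquiv ((Equiv.sumComm _ _)
          ((Equiv.sumComm _ _) (finSumFinEquiv.symm x)))
        simp }⟩

theorem nonempty_iso_juxt_permGraph {m n m' n' : ℕ} (σ : Fin m ≃ Fin n) (τ : Fin m' ≃ Fin n') :
    Nonempty (Iso ((permGraph σ).juxt (permGraph τ))
      (permGraph (finSumFinEquiv.symm.trans ((Equiv.sumCongr σ τ).trans finSumFinEquiv)))) :=
  ⟨{ onVert := Equiv.sumEmpty Empty Empty
     onHalf := Equiv.sumEmpty Empty Empty
     onEdge := finSumFinEquiv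
     vert_eq := by rintro (x | x) <;> exact x.elim
     next_eq := by rintro (x | x) <;> exact x.elim
     edge_eq := by
      rintro ((x | x) | (x | x))
      · exact x.elim
      · exact x.elim
      · induction x using Fin.addCases <;>
        · simp [juxt, permGraph, wiring, juxtEnds]
          rfl
      · induction x using Fin.addCases <;>
        · simp [juxt, permGraph, wiring, juxtEnds]
          rfl }⟩

/-! ### Permutations of the endpoints -/

namespace Generated

theorem permGraph_trans {l m n : ℕ} {σ : Fin l ≃ Fin m} {τ : Fin m ≃ Fin n}
    (hσ : Generated (permGraph σ)) (hτ : Generated (permGraph τ)) :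
    Generated (permGraph (σ.trans τ)) :=
  iso (nonempty_iso_permGraph_trans σ τ) (iso (nonempty_iso_comp_permGraph _ σ) (hτ.comp hσ))

theorem permGraph_finCongr {m n : ℕ} (h : m = n) : Generated (permGraph (finCongr h)) := by
  subst h
  exact strands m

theorem permGraph_pow {n : ℕ} {σ : Equiv.Perm (Fin n)} (h : Generated (permGraph σ)) (i : ℕ) :
    Generated (permGraph (σ ^ i)) := by
  induction i with
  | zero => exact strands n
  | succ i ih =>
    rw [pow_succ]
    exact permGraph_trans h ih

/-- The symmetric group is generated by a full cycle and an adjacent transposition. The cycle is a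
bundle of strands crossed with one strand; the transposition is `crossing 1 1` beside parallel
strands. -/
theorem permGraph_perm {n : ℕ} (σ : Equiv.Perm (Fin n)) : Generated (permGraph σ) := by
  rcases n with _ | _ | n
  · rw [Subsingleton.elim σ (Equiv.refl _)]
    exact strands 0
  · rw [Equiv.ext fun i => Subsingleton.elim (α := Fin 1) (σ i) (Equiv.refl _ i)]
    exact strands 1
  · have hrot : Generated (permGraph (finRotate (n + 2))) :=
      permGraph_trans (iso (nonempty_iso_crossing_permGraph (n + 1) 1) (crossing _ _))
        (permGraph_finCongr _)
    have hc : (finRotate (n + 2)).IsCycle := isCycle_finRotate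
    have hsupp : (finRotate (n + 2)).support = Finset.univ := support_finRotate
    let x : Fin (n + 2) := Fin.natAdd n (0 : Fin 2)
    have hswap : Generated (permGraph (Equiv.swap x (finRotate (n + 2) x))) := by
      have h := iso (nonempty_iso_juxt_permGraph (Equiv.refl (Fin n))
          (finAddFlip : Fin (1 + 1) ≃ Fin (1 + 1)))
        ((strands n).juxt (iso (nonempty_iso_crossing_permGraph 1 1) (crossing 1 1)))
      have hx : finRotate (n + 2) x = Fin.natAdd n (1 : Fin 2) :=
        finRotate_of_lt (Nat.lt_succ_self n)
      rw [hx]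
      convert h using 2
      refine Equiv.ext fun i => ?_
      induction i using Fin.addCases with
      | left i =>
        rw [Equiv.swap_apply_of_ne_of_ne]
        · simp
        · exact fun hi => absurd (congrArg Fin.val hi) (by simp [x]; omega)
        · exact fun hi => absurd (congrArg Fin.val hi) (by simp; omega)
      | right i =>
        fin_cases i
        · refine (Equiv.swap_apply_left x _).trans ?_
          simp
          rfl
        · refine (Equiv.swap_apply_right x _).trans ?_
          simp
          rfl
    have hmem : σ ∈ Subgroup.closure {finRotate (n + 2), Equiv.swap x (finRotate (n + 2) x)} := by
      rw [Equiv.Perm.closure_cycle_adjacent_swap hc hsupp x]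
      trivial
    induction hmem using Subgroup.closure_induction with
    | mem τ hτ =>
      rcases hτ with rfl | rfl
      · exact hrot
      · exact hswap
    | one => exact strands _
    | mul τ τ' _ _ h h' => exact permGraph_trans h' h
    | inv τ _ h =>
      -- In a finite group an inverse is a power, so closure under composition suffices.
      rw [inv_eq_of_mul_eq_one_right (b := τ ^ (orderOf τ - 1))
        (by rw [← pow_succ', Nat.sub_add_cancel (orderOf_pos τ), pow_orderOf_eq_one])]
      exact permGraph_pow h _

theorem permGraph_equiv {m n : ℕ} (σ : Fin m ≃ Fin n) : Generated (permGraph σ) := by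
  obtain rfl : m = n := by simpa using Fintype.card_congr σ
  exact permGraph_perm σ

theorem relabel {G : RibbonGraph p q} (h : Generated G) (σ : Fin p' ≃ Fin p)
    (τ : Fin q' ≃ Fin q) : Generated (G.relabel σ τ) := by
  have h1 := iso (nonempty_iso_comp_permGraph G σ) (h.comp (permGraph_equiv σ))
  refine iso ⟨?_⟩ (iso (nonempty_iso_permGraph_comp _ τ) ((permGraph_equiv τ.symm).comp h1))
  exact
   { onVert := Equiv.refl _
     onHalf := Equiv.refl _
     onEdge := Equiv.refl _
     vert_eq := fun _ => rfl
     next_eq := fun _ => rfl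
     edge_eq := by rintro (x | (x | x)) <;> rfl }

end Generated

/-! ### Splitting a graph -/

section Restrict

variable (G : RibbonGraph p q) (P : G.Vert → Prop) (Q : G.Edge → Prop)
  (h : ∀ x, P (G.vert x) ↔ Q (G.edge (Sum.inl x)))
  (α : Fin p' ≃ {i // Q (G.edge (Sum.inr (Sum.inl i)))})
  (β : Fin q' ≃ {j // Q (G.edge (Sum.inr (Sum.inr j)))})

/-- The ends of a union of components, as ends of the whole graph. -/
def restrictEnd : {x : G.Half // P (G.vert x)} ⊕ (Fin p' ⊕ Fin q') → G.Half ⊕ (Fin p ⊕ Fin q) :=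
  Sum.map Subtype.val (Sum.map (fun i => (α i).1) fun j => (β j).1)

include h in
theorem restrictEnd_mem (x) : Q (G.edge (G.restrictEnd P Q α β x)) := by
  rcases x with x | (x | x)
  · exact (h _).1 x.2
  · exact (α x).2
  · exact (β x).2

theorem restrictEnd_injective : Function.Injective (G.restrictEnd P Q α β) :=
  Sum.map_injective.2 ⟨Subtype.val_injective, Sum.map_injective.2
    ⟨Subtype.val_injective.comp α.injective, Subtype.val_injective.comp β.injective⟩⟩

include h in
theorem exists_restrictEnd {y} (hy : Q (G.edge y)) : ∃ x, G.restrictEnd P Q α β x = y := by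
  rcases y with y | (y | y)
  · exact ⟨Sum.inl ⟨y, (h y).2 hy⟩, rfl⟩
  · exact ⟨Sum.inr (Sum.inl (α.symm ⟨y, hy⟩)), by simp [restrictEnd]⟩
  · exact ⟨Sum.inr (Sum.inr (β.symm ⟨y, hy⟩)), by simp [restrictEnd]⟩

/-- The union of the components of a graph that consist of the vertices satisfying `P` and the edges
satisfying `Q`. -/
def restrict : RibbonGraph p' q' where
  Vert := {v // P v}
  Half := {x // P (G.vert x)}
  Edge := {a // Q a}
  finite_vert := inferInstance
  finite_half := inferInstance
  finite_edge := inferInstance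
  vert x := ⟨G.vert x.1, x.2⟩
  next := G.next.subtypePerm fun x => by
    rw [(G.sameCycle_iff (G.next x) x).1 (Equiv.Perm.sameCycle_apply_left.2 (.refl _ _))]
  sameCycle_iff x y := by
    rw [Equiv.Perm.sameCycle_subtypePerm, G.sameCycle_iff, Subtype.mk.injEq]
  edge x := ⟨G.edge (G.restrictEnd P Q α β x), G.restrictEnd_mem P Q h α β x⟩
  other_end x := by
    obtain ⟨y, ⟨hy1, hy2⟩, hu⟩ := G.other_end (G.restrictEnd P Q α β x)
    obtain ⟨y, rfl⟩ := G.exists_restrictEnd P Q h α β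
      (hy2 ▸ G.restrictEnd_mem P Q h α β x)
    refine ⟨y, ⟨fun hh => hy1 (congrArg _ hh), Subtype.ext hy2⟩, fun z hz => ?_⟩
    exact G.restrictEnd_injective P Q α β
      (hu _ ⟨fun hh => hz.1 (G.restrictEnd_injective P Q α β hh), congrArg Subtype.val hz.2⟩)

end Restrict

/-- By `h`, no edge runs between the parts selected by the predicates and their complements, so only
the numbering of the endpoints distinguishes `G` from the juxtaposition. -/
theorem nonempty_iso_restrict {p'' q'' : ℕ} (G : RibbonGraph p q) (P : G.Vert → Prop)
    (Q : G.Edge → Prop)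
    [DecidablePred P] [DecidablePred Q]
    (h : ∀ x, P (G.vert x) ↔ Q (G.edge (Sum.inl x)))
    (h' : ∀ x, ¬ P (G.vert x) ↔ ¬ Q (G.edge (Sum.inl x)))
    (α : Fin p' ≃ {i // Q (G.edge (Sum.inr (Sum.inl i)))})
    (β : Fin q' ≃ {j // Q (G.edge (Sum.inr (Sum.inr j)))})
    (α' : Fin p'' ≃ {i // ¬ Q (G.edge (Sum.inr (Sum.inl i)))})
    (β' : Fin q'' ≃ {j // ¬ Q (G.edge (Sum.inr (Sum.inr j)))}) :
    Nonempty (Iso (((G.restrict P Q h α β).juxt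
        (G.restrict (fun v => ¬ P v) (fun a => ¬ Q a) h' α' β')).relabel
      ((Equiv.sumCompl _).symm.trans ((Equiv.sumCongr α.symm α'.symm).trans finSumFinEquiv))
      ((Equiv.sumCompl _).symm.trans ((Equiv.sumCongr β.symm β'.symm).trans finSumFinEquiv)))
      G) :=
  ⟨{ onVert := Equiv.sumCompl P
     onHalf := Equiv.sumCompl fun x => P (G.vert x)
     onEdge := Equiv.sumCompl Q
     vert_eq := by rintro (x | x) <;> rfl
     next_eq := by rintro (x | x) <;> rfl
     edge_eq := by
      rintro ((x | x) | (x | x))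
      · rfl
      · rfl
      · by_cases hx : Q (G.edge (Sum.inr (Sum.inl x)))
        · simp [RibbonGraph.relabel, juxt, restrict, restrictEnd, juxtEnds, hx]
          rfl
        · simp [RibbonGraph.relabel, juxt, restrict, restrictEnd, juxtEnds, hx]
          rfl
      · by_cases hx : Q (G.edge (Sum.inr (Sum.inr x)))
        · simp [RibbonGraph.relabel, juxt, restrict, restrictEnd, juxtEnds, hx]
          rfl
        · simp [RibbonGraph.relabel, juxt, restrict, restrictEnd, juxtEnds, hx]
          rfl }⟩

/-- The induction device for splitting off components. How the endpoints of the pieces are numbered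
is immaterial, since permutation graphs are generated. -/
theorem Generated.of_restrict (G : RibbonGraph p q) (P : G.Vert → Prop) (Q : G.Edge → Prop)
    (h : ∀ x, P (G.vert x) ↔ Q (G.edge (Sum.inl x)))
    (H : ∀ (p' q' : ℕ) (α : Fin p' ≃ {i // Q (G.edge (Sum.inr (Sum.inl i)))})
      (β : Fin q' ≃ {j // Q (G.edge (Sum.inr (Sum.inr j)))}),
      Generated (G.restrict P Q h α β))
    (H' : ∀ (h' : ∀ x, ¬ P (G.vert x) ↔ ¬ Q (G.edge (Sum.inl x))) (p' q' : ℕ)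
      (α : Fin p' ≃ {i // ¬ Q (G.edge (Sum.inr (Sum.inl i)))})
      (β : Fin q' ≃ {j // ¬ Q (G.edge (Sum.inr (Sum.inr j)))}),
      Generated (G.restrict (fun v => ¬ P v) (fun a => ¬ Q a) h' α β)) :
    Generated G := by
  classical
  exact Generated.iso (G.nonempty_iso_restrict P Q h (fun x => not_congr (h x))
      (Finite.equivFin _).symm (Finite.equivFin _).symm (Finite.equivFin _).symm
      (Finite.equivFin _).symm)
    (((H _ _ _ _).juxt (H' _ _ _ _ _)).relabel _ _)

end RibbonGraph

namespace RibbonGraph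

variable {p q r p' q' : ℕ}

/-! ### Graphs without vertices -/

theorem isEmpty_half (G : RibbonGraph p q) [IsEmpty G.Vert] : IsEmpty G.Half :=
  ⟨fun x => IsEmpty.false (G.vert x)⟩

/-- There is nothing to compare besides the endpoints, all of which lie on the single edge. This is
how the graphical identities for arcs and strands are verified below. -/
theorem nonempty_iso_of_unique_edge (G G' : RibbonGraph p q) [IsEmpty G.Vert] [IsEmpty G'.Vert]
    [Unique G.Edge] [Unique G'.Edge] : Nonempty (Iso G G') :=
  have := G.isEmpty_half
  have := G'.isEmpty_half
  ⟨{ onVert := Equiv.equivOfIsEmpty _ _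
     onHalf := Equiv.equivOfIsEmpty _ _
     onEdge := Equiv.ofUnique _ _
     vert_eq := isEmptyElim
     next_eq := isEmptyElim
     edge_eq := fun _ => Subsingleton.elim _ _ }⟩

/-- Without ends the edge is a circle, which is `arc` glued to `coarc`. Otherwise it has two ends,
and the number of incoming ones distinguishes `coarc`, a strand and `arc`. -/
theorem Generated.of_unique_edge (G : RibbonGraph p q) [IsEmpty G.Vert] [Unique G.Edge] :
    Generated G := by
  have := G.isEmpty_half
  by_cases hends : IsEmpty (Fin p ⊕ Fin q)
  · rw [isEmpty_sum] at hends
    obtain rfl : p = 0 := Nat.eq_zero_of_not_pos fun h => hends.1.false ⟨0, h⟩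
    obtain rfl : q = 0 := Nat.eq_zero_of_not_pos fun h => hends.2.false ⟨0, h⟩
    have : IsEmpty (RibbonGraph.arc.comp RibbonGraph.coarc).Vert :=
      inferInstanceAs (IsEmpty (Empty ⊕ Empty))
    have hmk : ∀ a, a = (Quot.mk _ (Sum.inl ()) :
        (RibbonGraph.arc.comp RibbonGraph.coarc).Edge) := by
      rintro ⟨⟨⟩ | ⟨⟩⟩
      · rfl
      · exact (Quot.sound ⟨0, rfl, rfl⟩).symm
    let _ : Unique (RibbonGraph.arc.comp RibbonGraph.coarc).Edge := ⟨⟨_⟩, hmk⟩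
    exact Generated.iso (nonempty_iso_of_unique_edge _ _) (Generated.arc.comp Generated.coarc)
  · rw [not_isEmpty_iff] at hends
    obtain ⟨x⟩ := hends
    have hcard : Nat.card (Fin p ⊕ Fin q) = 2 := by
      obtain ⟨y | y, hy, hu⟩ := G.other_end (Sum.inr x)
      · exact isEmptyElim y
      · refine Nat.card_eq_two_iff.2 ⟨x, y, fun h => hy.1 (congrArg _ h.symm), ?_⟩
        refine Set.eq_univ_of_forall fun z => ?_
        by_cases hz : z = x
        · exact Or.inl hz
        · exact Or.inr (Sum.inr_injective (hu (Sum.inr z)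
            ⟨fun h => hz (Sum.inr_injective h), Subsingleton.elim _ _⟩))
    simp only [Nat.card_eq_fintype_card, Fintype.card_sum, Fintype.card_fin] at hcard
    have hp : p ≤ 2 := by omega
    interval_cases p
    · obtain rfl : q = 2 := by omega
      have : IsEmpty RibbonGraph.coarc.Vert := inferInstanceAs (IsEmpty Empty)
      let _ : Unique RibbonGraph.coarc.Edge := inferInstanceAs (Unique Unit)
      exact Generated.iso (nonempty_iso_of_unique_edge _ _) Generated.coarc
    · obtain rfl : q = 1 := by omega
      have : IsEmpty (RibbonGraph.strands 1).Vert := inferInstanceAs (IsEmpty Empty)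
      let _ : Unique (RibbonGraph.strands 1).Edge := inferInstanceAs (Unique (Fin 1))
      exact Generated.iso (nonempty_iso_of_unique_edge _ _) (Generated.strands 1)
    · obtain rfl : q = 0 := by omega
      have : IsEmpty RibbonGraph.arc.Vert := inferInstanceAs (IsEmpty Empty)
      let _ : Unique RibbonGraph.arc.Edge := inferInstanceAs (Unique Unit)
      exact Generated.iso (nonempty_iso_of_unique_edge _ _) Generated.arc

theorem Generated.of_isEmpty_vert (G : RibbonGraph p q) [IsEmpty G.Vert] : Generated G := by
  induction hn : Nat.card G.Edge using Nat.strong_induction_on generalizing p q with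
  | _ n ih =>
  have := G.isEmpty_half
  by_cases hE : IsEmpty G.Edge
  · have hends : IsEmpty (Fin p ⊕ Fin q) := ⟨fun x => hE.false (G.edge (Sum.inr x))⟩
    rw [isEmpty_sum] at hends
    obtain rfl : p = 0 := Nat.eq_zero_of_not_pos fun h => hends.1.false ⟨0, h⟩
    obtain rfl : q = 0 := Nat.eq_zero_of_not_pos fun h => hends.2.false ⟨0, h⟩
    refine Generated.iso ⟨?_⟩ (Generated.strands 0)
    have : IsEmpty (RibbonGraph.strands 0).Vert := inferInstanceAs (IsEmpty Empty)
    have : IsEmpty (RibbonGraph.strands 0).Half := inferInstanceAs (IsEmpty Empty)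
    have : IsEmpty (RibbonGraph.strands 0).Edge := inferInstanceAs (IsEmpty (Fin 0))
    exact
     { onVert := Equiv.equivOfIsEmpty _ _
       onHalf := Equiv.equivOfIsEmpty _ _
       onEdge := Equiv.equivOfIsEmpty _ _
       vert_eq := isEmptyElim
       next_eq := isEmptyElim
       edge_eq := fun x => isEmptyElim ((RibbonGraph.strands 0).edge x) }
  · rw [not_isEmpty_iff] at hE
    obtain ⟨a⟩ := hE
    -- A single edge is a component when there are no vertices; splitting it off lowers the number
    -- of edges.
    refine Generated.of_restrict G (fun _ => True) (fun c => c = a) (fun x => isEmptyElim x)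
      (fun p' q' α β => ?_) (fun h' p' q' α β => ?_)
    · have : IsEmpty (G.restrict (fun _ => True) (fun c => c = a)
        (fun x => isEmptyElim x) α β).Vert := ⟨fun v => isEmptyElim v.1⟩
      let _ : Unique (G.restrict (fun _ => True) (fun c => c = a)
        (fun x => isEmptyElim x) α β).Edge := inferInstanceAs (Unique {c // c = a})
      exact Generated.of_unique_edge _
    · have : IsEmpty (G.restrict (fun v => ¬ True) (fun c => ¬ c = a) h' α β).Vert :=
        ⟨fun v => isEmptyElim v.1⟩
      refine ih _ ?_ _ rfl
      rw [← hn]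
      exact Finite.card_subtype_lt (x := a) (by simp)

/-! ### Graphs all of whose edges end at exactly one incoming endpoint -/

/-- Every edge has exactly one incoming endpoint. -/
def IsIncoming (G : RibbonGraph p q) : Prop :=
  Function.Bijective fun i => G.edge (Sum.inr (Sum.inl i))

/-- Both ends are the unique partner of the incoming endpoint of their edge. -/
theorem IsIncoming.eq_of_edge_eq {G : RibbonGraph p q} (hG : G.IsIncoming)
    {x y : G.Half ⊕ (Fin p ⊕ Fin q)} (hx : ∀ i, x ≠ Sum.inr (Sum.inl i))
    (hy : ∀ i, y ≠ Sum.inr (Sum.inl i)) (h : G.edge x = G.edge y) : x = y := by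
  obtain ⟨i, hi⟩ := hG.surjective (G.edge x)
  exact (G.other_end (Sum.inr (Sum.inl i))).unique ⟨hx i, hi.symm⟩ ⟨hy i, h.symm.trans hi.symm⟩

theorem IsIncoming.restrict {G : RibbonGraph p q} (hG : G.IsIncoming) {P : G.Vert → Prop}
    {Q : G.Edge → Prop} {h : ∀ x, P (G.vert x) ↔ Q (G.edge (Sum.inl x))}
    {α : Fin p' ≃ {i // Q (G.edge (Sum.inr (Sum.inl i)))}}
    {β : Fin q' ≃ {j // Q (G.edge (Sum.inr (Sum.inr j)))}} :
    (G.restrict P Q h α β).IsIncoming := by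
  constructor
  · intro i j hij
    exact α.injective (Subtype.ext (hG.injective (congrArg Subtype.val hij)))
  · rintro ⟨a, ha⟩
    obtain ⟨i, rfl⟩ := hG.surjective a
    exact ⟨α.symm ⟨i, ha⟩, Subtype.ext (by simp [RibbonGraph.restrict, restrictEnd])⟩

/-- Each edge joins one input to one half-edge, which leaves no room for outputs: the graph is a
corolla with renumbered inputs. -/
theorem Generated.of_unique_vert (G : RibbonGraph p q) (hG : G.IsIncoming) (v : G.Vert)
    (hv : ∀ w, w = v) (hE : ∀ a, ∃ x, G.edge (Sum.inl x) = a) : Generated G := by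
  have hq : q = 0 := by
    by_contra hq
    obtain ⟨x, hx⟩ := hE (G.edge (Sum.inr (Sum.inr ⟨0, Nat.pos_of_ne_zero hq⟩)))
    have := hG.eq_of_edge_eq (by simp) (by simp) hx
    simp at this
  subst hq
  have hinj : Function.Injective fun x => G.edge (Sum.inl x) := fun x y hxy =>
    Sum.inl_injective (hG.eq_of_edge_eq (by simp) (by simp) hxy)
  let eH : G.Half ≃ G.Edge := Equiv.ofBijective _ ⟨hinj, hE⟩
  let eI : Fin p ≃ G.Edge := Equiv.ofBijective _ hG
  have hν := G.isCyclicNumbering_numbering v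
  let ν : Fin (G.valence v) ≃ G.Half :=
    Equiv.ofBijective _ ⟨hν.injective, fun x => (hν.vert_eq_iff x).1 (hv _)⟩
  refine Generated.iso ⟨?_⟩ ((Generated.corolla (G.valence v)).relabel
    (eI.trans (eH.symm.trans ν.symm)) (Equiv.refl _))
  exact
   { onVert := ⟨fun _ => v, fun _ => (), fun _ => rfl, fun w => (hv w).symm⟩
     onHalf := ν
     onEdge := ν.trans eH
     vert_eq := fun x => hv _
     next_eq := hν.next_eq
     edge_eq := by
      rintro (x | (x | x))
      · rfl
      · change eI x = eH (ν (ν.symm (eH.symm (eI x))))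
        simp
      · exact x.elim0 }

/-- No edge joins two half-edges, so a vertex together with its edges is a component and can be
split off. Edges that meet no vertex remain for the vertexless case. -/
theorem Generated.of_isIncoming (G : RibbonGraph p q) (hG : G.IsIncoming) : Generated G := by
  induction hn : Nat.card G.Vert using Nat.strong_induction_on generalizing p q with
  | _ n ih =>
  by_cases hV : IsEmpty G.Vert
  · exact Generated.of_isEmpty_vert G
  · rw [not_isEmpty_iff] at hV
    obtain ⟨v⟩ := hV
    refine Generated.of_restrict G (fun w => w = v)
      (fun a => ∃ x, G.vert x = v ∧ G.edge (Sum.inl x) = a) (fun x => ?_)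
      (fun p' q' α β => ?_) (fun h' p' q' α β => ?_)
    · refine ⟨fun hx => ⟨x, hx, rfl⟩, ?_⟩
      rintro ⟨y, hy, hxy⟩
      rw [← Sum.inl_injective (hG.eq_of_edge_eq (by simp) (by simp) hxy), hy]
    · refine Generated.of_unique_vert _ hG.restrict ⟨v, rfl⟩ (fun w => Subtype.ext w.2) ?_
      rintro ⟨a, x, hx, rfl⟩
      exact ⟨⟨x, hx⟩, rfl⟩
    · refine ih _ ?_ _ hG.restrict rfl
      rw [← hn]
      exact Finite.card_subtype_lt (x := v) (by simp)

/-! ### The general case -/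

/-- Cut every edge next to its half-edges and outgoing endpoints. The part `X` above the cuts has
one edge from a new input to each half-edge or output; the part `W` below keeps the original edges
and has no vertices. -/
theorem generated (G : RibbonGraph p q) : Generated G := by
  -- One cut for each half-edge and each outgoing endpoint; `ε` numbers the cuts.
  obtain ⟨m, ⟨ε⟩⟩ : ∃ m, Nonempty (Fin m ≃ G.Half ⊕ Fin q) :=
    ⟨_, ⟨(Finite.equivFin _).symm⟩⟩
  let e : Fin p ⊕ (G.Half ⊕ Fin q) ≃ G.Half ⊕ (Fin p ⊕ Fin q) :=
    (Equiv.sumAssoc _ _ _).symm.trans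
      ((Equiv.sumCongr (Equiv.sumComm _ _) (Equiv.refl _)).trans (Equiv.sumAssoc _ _ _))
  let e' : G.Half ⊕ (Fin m ⊕ Fin q) ≃ (G.Half ⊕ Fin q) ⊕ Fin m :=
    (Equiv.sumCongr (Equiv.refl _) (Equiv.sumComm _ _)).trans (Equiv.sumAssoc _ _ _).symm
  let W : RibbonGraph p m := wiring G.Edge inferInstance
    (fun x => G.edge ((Equiv.sumCongr (Equiv.refl _) ε).trans e x))
    (existsUnique_other_comp_equiv _ G.other_end)
  let X : RibbonGraph m q :=
    { Vert := G.Vert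
      Half := G.Half
      Edge := G.Half ⊕ Fin q
      finite_vert := inferInstance
      finite_half := inferInstance
      finite_edge := inferInstance
      vert := G.vert
      next := G.next
      sameCycle_iff := G.sameCycle_iff
      edge := fun x => Sum.elim (Equiv.refl _) ε (e' x)
      other_end := existsUnique_other_comp_equiv e' (existsUnique_other_of_equiv _ _) }
  have hX : X.IsIncoming := ε.bijective
  have : IsEmpty W.Vert := inferInstanceAs (IsEmpty Empty)
  refine Generated.iso ?_ ((Generated.of_isIncoming X hX).comp (Generated.of_isEmpty_vert W))
  refine nonempty_iso_comp (L := G) (Equiv.sumEmpty G.Vert Empty) (Equiv.sumEmpty G.Half Empty)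
    (Sum.elim (fun x : G.Half ⊕ Fin q => G.edge (e (Sum.inr x))) id) Sum.inr ?_ ?_ ?_ ?_ ?_ ?_
  · rintro (x | x)
    exacts [rfl, x.elim]
  · rintro (x | x)
    exacts [rfl, x.elim]
  · exact fun i => rfl
  · exact fun c => rfl
  · rintro (x | a)
    · refine Quot.sound ⟨ε.symm x, congrArg Sum.inl ?_, congrArg Sum.inr ?_⟩
      · exact (ε.apply_symm_apply x).symm
      · change G.edge (e (Sum.inr x)) = G.edge (e (Sum.inr (ε (ε.symm x))))
        rw [ε.apply_symm_apply]
    · rfl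
  · rintro ((x | x) | (x | x))
    exacts [rfl, x.elim, rfl, rfl]

end RibbonGraph

/-! ## The cyclic algebra attached to an algebra over the PROP of ribbon graphs -/

section

variable {k : Type u} [Field k] {V : Type v} [AddCommGroup V] [Module k V]

namespace RG

variable {p q r p' q' : ℕ}

theorem of_eq_of_iso {G G' : RibbonGraph p q} (h : Nonempty (RibbonGraph.Iso G G')) :
    of k G = of k G' := by
  rw [of, of, Quotient.sound h]

theorem comp_of (G : RibbonGraph q r) (K : RibbonGraph p q) :
    comp (of k G) (of k K) = of k (G.comp K) := by
  simp only [comp, of, Finsupp.linearCombination_single, one_smul, Finsupp.lmapDomain_apply,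
    Finsupp.mapDomain_single]
  rfl

theorem tensor_of (G : RibbonGraph p q) (K : RibbonGraph p' q') :
    tensor (of k G) (of k K) = of k (G.juxt K) := by
  simp only [tensor, of, Finsupp.linearCombination_single, one_smul, Finsupp.lmapDomain_apply,
    Finsupp.mapDomain_single]
  rfl

end RG

namespace EndProp

theorem scalar_tprod (x : Fin 0 → V) : scalar k V (PiTensorProduct.tprod k x) = 1 :=
  PiTensorProduct.isEmptyEquiv_apply_tprod _ _

theorem eq_scalar_smul (t : ⨂[k]^0 V) :
    t = scalar k V t • PiTensorProduct.tprod k (Fin.elim0 : Fin 0 → V) := by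
  apply (scalar k V).injective
  rw [map_smul, scalar_tprod, smul_eq_mul, mul_one]

/-- The canonical identification of `V^{⊗1}` with `V`. -/
noncomputable def single : (⨂[k]^1 V) ≃ₗ[k] V := PiTensorProduct.subsingletonEquiv (0 : Fin 1)

theorem single_tprod (x : Fin 1 → V) : single (PiTensorProduct.tprod k x) = x 0 :=
  PiTensorProduct.subsingletonEquiv_apply_tprod _ _

/-- The contraction `c ⊗ c' ↦ b(x, c) c'`. -/
noncomputable def contractLeft (b : V →ₗ[k] V →ₗ[k] k) (x : V) : (⨂[k]^2 V) →ₗ[k] V :=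
  (TensorProduct.lid k V).toLinearMap ∘ₗ
    TensorProduct.map (b x ∘ₗ (single (k := k) (V := V)).toLinearMap)
      (single (k := k) (V := V)).toLinearMap ∘ₗ
    (TensorPower.mulEquiv (R := k) (M := V) (n := 1) (m := 1)).symm.toLinearMap

theorem contractLeft_tprod (b : V →ₗ[k] V →ₗ[k] k) (x : V) (c : Fin 2 → V) :
    contractLeft b x (PiTensorProduct.tprod k c) = b x (c 0) • c 1 := by
  have h := mulEquiv_symm_tprod (k := k) (m := 1) (n := 1) c
  simp only [contractLeft, LinearMap.comp_apply, LinearEquiv.coe_coe]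
  erw [h]
  simp only [TensorProduct.map_tmul, LinearMap.comp_apply, LinearEquiv.coe_coe, single_tprod,
    TensorProduct.lid_tmul]
  rfl

end EndProp

namespace RGAlgebra

variable (Z : RGAlgebra k V) {p q r p' q' : ℕ}

theorem act_of_comp (G : RibbonGraph q r) (K : RibbonGraph p q) :
    Z.act (RG.of k (G.comp K)) = Z.act (RG.of k G) ∘ₗ Z.act (RG.of k K) := by
  rw [← RG.comp_of, Z.act_comp]

theorem act_of_juxt (G : RibbonGraph p q) (K : RibbonGraph p' q') :
    Z.act (RG.of k (G.juxt K)) = EndProp.tensor (Z.act (RG.of k G)) (Z.act (RG.of k K)) := by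
  rw [← RG.tensor_of, Z.act_tensor]

/-- The inner product of an algebra over the PROP of ribbon graphs. -/
noncomputable def inner : V →ₗ[k] V →ₗ[k] k :=
  let M := ((EndProp.scalar k V).toLinearMap ∘ₗ
    Z.act (RG.of k RibbonGraph.arc)).compMultilinearMap (PiTensorProduct.tprod k)
  have h0 : ∀ x y z : V, Function.update ![x, y] 0 z = ![z, y] := fun x y z => by
    funext i; fin_cases i <;> rfl
  have h1 : ∀ x y z : V, Function.update ![x, y] 1 z = ![x, z] := fun x y z => by
    funext i; fin_cases i <;> rfl
  LinearMap.mk₂ k (fun x y => M ![x, y])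
    (fun x x' y => by simpa only [h0] using M.map_update_add ![x, y] 0 x x')
    (fun c x y => by simpa only [h0] using M.map_update_smul ![x, y] 0 c x)
    (fun x y y' => by simpa only [h1] using M.map_update_add ![x, y] 1 y y')
    (fun c x y => by simpa only [h1] using M.map_update_smul ![x, y] 1 c y)

theorem inner_apply (x y : V) : Z.inner x y = EndProp.scalar k V
    (Z.act (RG.of k RibbonGraph.arc) (PiTensorProduct.tprod k ![x, y])) := rfl

theorem act_arc_tprod (x : Fin 2 → V) :
    Z.act (RG.of k RibbonGraph.arc) (PiTensorProduct.tprod k x) =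
      Z.inner (x 0) (x 1) • PiTensorProduct.tprod k (Fin.elim0 : Fin 0 → V) := by
  have hx : x = ![x 0, x 1] := by
    funext i
    fin_cases i <;> rfl
  conv_lhs => rw [hx]
  exact EndProp.eq_scalar_smul _

/-- Both strands of the crossing are glued to the arc, so the composite is again a single arc. -/
theorem inner_symm (x y : V) : Z.inner x y = Z.inner y x := by
  have : IsEmpty (RibbonGraph.arc.comp (RibbonGraph.crossing 1 1)).Vert :=
    inferInstanceAs (IsEmpty (Empty ⊕ Empty))
  have : IsEmpty RibbonGraph.arc.Vert := inferInstanceAs (IsEmpty Empty)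
  let _ : Unique RibbonGraph.arc.Edge := inferInstanceAs (Unique Unit)
  have hmk : ∀ a, a = (Quot.mk _ (Sum.inl ()) :
      (RibbonGraph.arc.comp (RibbonGraph.crossing 1 1)).Edge) := by
    rintro ⟨⟨⟩ | a⟩
    · rfl
    · rcases a with a | a
      · refine (Quot.sound ⟨1, rfl, ?_⟩).symm
        obtain rfl := Subsingleton.elim a 0
        rfl
      · refine (Quot.sound ⟨0, rfl, ?_⟩).symm
        obtain rfl := Subsingleton.elim a 0
        rfl
  let _ : Unique (RibbonGraph.arc.comp (RibbonGraph.crossing 1 1)).Edge := ⟨⟨_⟩, hmk⟩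
  have h := RG.of_eq_of_iso (k := k) (RibbonGraph.nonempty_iso_of_unique_edge
    (RibbonGraph.arc.comp (RibbonGraph.crossing 1 1)) RibbonGraph.arc)
  have h' := (congrArg Z.act h).symm.trans
    (Z.act_of_comp RibbonGraph.arc (RibbonGraph.crossing 1 1))
  have hc := (LinearMap.congr_fun (Z.act_crossing 1 1) (PiTensorProduct.tprod k ![x, y])).trans
    (EndProp.braiding_tprod (k := k) (m := 1) (n := 1) ![x, y])
  rw [inner_apply, inner_apply]
  refine congrArg _ ((LinearMap.congr_fun h' _).trans
    (congrArg (Z.act (RG.of k RibbonGraph.arc)) (hc.trans (congrArg _ ?_))))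
  funext i
  fin_cases i <;> rfl

/-- Precomposing a corolla with `crossing n 1` rotates its inputs, and rotating the half-edges
undoes this up to isomorphism. -/
theorem act_corolla_tprod_cyclic (n : ℕ) (x : Fin (n + 1) → V) :
    EndProp.scalar k V (Z.act (RG.of k (RibbonGraph.corolla (n + 1)))
        (PiTensorProduct.tprod k x)) =
      EndProp.scalar k V (Z.act (RG.of k (RibbonGraph.corolla (n + 1)))
        (PiTensorProduct.tprod k (x ∘ (finRotate (n + 1)).symm))) := by
  -- The crossing ends in `1 + n` strands rather than `n + 1`; a general `m` with `m = n + 1` allows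
  -- the cast to be eliminated.
  have hiso : ∀ (m : ℕ) (h : m = n + 1) (σ : Fin (n + 1) ≃ Fin m),
      σ.trans (finCongr h) = finRotate (n + 1) →
      Nonempty (RibbonGraph.Iso ((RibbonGraph.corolla m).relabel σ (Equiv.refl _))
        (RibbonGraph.corolla (n + 1))) := by
    rintro m rfl σ hσ
    obtain rfl : σ = finRotate (n + 1) := by rw [← hσ]; rfl
    refine ⟨RibbonGraph.Iso.symm ?_⟩
    exact
     { onVert := Equiv.refl _
       onHalf := finRotate (n + 1)
       onEdge := finRotate (n + 1)
       vert_eq := fun _ => rfl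
       next_eq := fun _ => rfl
       edge_eq := by
        rintro (x | (x | x))
        · rfl
        · rfl
        · exact x.elim0 }
  have hcast : ∀ (m : ℕ) (h : m = n + 1) (y : Fin (n + 1) → V),
      EndProp.scalar k V (Z.act (RG.of k (RibbonGraph.corolla m))
        (PiTensorProduct.tprod k (y ∘ finCongr h))) =
      EndProp.scalar k V (Z.act (RG.of k (RibbonGraph.corolla (n + 1)))
        (PiTensorProduct.tprod k y)) := by
    rintro m rfl y
    rfl
  rw [← hcast (1 + n) (Nat.add_comm 1 n) (x ∘ (finRotate (n + 1)).symm),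
    ← RG.of_eq_of_iso (hiso (1 + n) (Nat.add_comm 1 n) finAddFlip rfl),
    ← RG.of_eq_of_iso (RibbonGraph.nonempty_iso_comp_permGraph _ _), act_of_comp,
    ← RG.of_eq_of_iso (RibbonGraph.nonempty_iso_crossing_permGraph n 1), Z.act_crossing,
    LinearMap.comp_apply, EndProp.braiding_tprod]
  congr 3

/-- The value of the arc that joins two outgoing endpoints. -/
noncomputable def copairing : ⨂[k]^2 V :=
  Z.act (RG.of k RibbonGraph.coarc) (PiTensorProduct.tprod k (Fin.elim0 : Fin 0 → V))

theorem tensor_arc_id (x : V) (t : ⨂[k]^2 V) :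
    EndProp.single (EndProp.tensor (Z.act (RG.of k RibbonGraph.arc)) (LinearMap.id (M := ⨂[k]^1 V))
      (TensorPower.mulEquiv (n := 1) (m := 2)
        (PiTensorProduct.tprod k (fun _ : Fin 1 => x) ⊗ₜ[k] t))) =
      EndProp.contractLeft Z.inner x t := by
  let L : (⨂[k]^2 V) →ₗ[k] V := EndProp.single.toLinearMap ∘ₗ
    (EndProp.tensor (Z.act (RG.of k RibbonGraph.arc)) (LinearMap.id (M := ⨂[k]^1 V)) :
      (⨂[k]^3 V) →ₗ[k] (⨂[k]^1 V)) ∘ₗ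
    (TensorPower.mulEquiv (n := 1) (m := 2)).toLinearMap ∘ₗ
    TensorProduct.mk k _ _ (PiTensorProduct.tprod k (fun _ : Fin 1 => x))
  suffices h : L = EndProp.contractLeft Z.inner x from LinearMap.congr_fun h t
  ext c
  rw [LinearMap.compMultilinearMap_apply, LinearMap.compMultilinearMap_apply,
    EndProp.contractLeft_tprod]
  change EndProp.single (EndProp.tensor (p := 2) (q := 0) (p' := 1) (q' := 1)
    (Z.act (RG.of k RibbonGraph.arc)) (LinearMap.id (M := ⨂[k]^1 V)) (TensorPower.mulEquiv (n := 1) (m := 2)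
    (PiTensorProduct.tprod k (fun _ : Fin 1 => x) ⊗ₜ[k] PiTensorProduct.tprod k c))) = _
  rw [TensorPower.mulEquiv_tprod]
  erw [EndProp.tensor_tprod (k := k) (p := 2) (p' := 1) (q := 0) (q' := 1)]
  rw [act_arc_tprod, LinearMap.id_apply, ← TensorProduct.smul_tmul', map_smul,
    TensorPower.mulEquiv_tprod, map_smul]
  congr 1
  exact (EndProp.single_tprod _).trans rfl

/-- The zigzag identity: the strand beside a `coarc`, followed by an `arc` beside a strand, is one
edge from input to output. -/
theorem contractLeft_copairing (x : V) : EndProp.contractLeft Z.inner x Z.copairing = x := by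
  let L : RibbonGraph 1 1 := RibbonGraph.comp (q := 3)
    (RibbonGraph.juxt RibbonGraph.arc (RibbonGraph.strands 1))
    (RibbonGraph.juxt (RibbonGraph.strands 1) RibbonGraph.coarc)
  have : IsEmpty L.Vert := inferInstanceAs (IsEmpty ((Empty ⊕ Empty) ⊕ (Empty ⊕ Empty)))
  have : IsEmpty (RibbonGraph.strands 1).Vert := inferInstanceAs (IsEmpty Empty)
  let _ : Unique (RibbonGraph.strands 1).Edge := inferInstanceAs (Unique (Fin 1))
  let a₀ : L.Edge := Quot.mk _ (Sum.inl (Sum.inl ()))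
  -- The three gluings, at the points `0`, `1` and `2`, merge the four edges into one.
  have h1 : (Quot.mk _ (Sum.inr (Sum.inl (0 : Fin 1))) : L.Edge) = a₀ :=
    (Quot.sound ⟨0, rfl, rfl⟩).symm
  have h2 : (Quot.mk _ (Sum.inr (Sum.inr ())) : L.Edge) = a₀ :=
    (Quot.sound ⟨1, rfl, rfl⟩).symm
  have h3 : (Quot.mk _ (Sum.inl (Sum.inr (0 : Fin 1))) : L.Edge) = a₀ :=
    (Quot.sound ⟨2, rfl, rfl⟩ : (Quot.mk _ _ : L.Edge) = Quot.mk _ _).trans h2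
  have hmk : ∀ a : L.Edge, a = a₀ := by
    rintro ⟨(⟨⟩ | a) | (a | ⟨⟩)⟩
    · rfl
    · obtain rfl := Subsingleton.elim a (0 : Fin 1)
      exact h3
    · obtain rfl := Subsingleton.elim a (0 : Fin 1)
      exact h1
    · exact h2
  let _ : Unique L.Edge := ⟨⟨a₀⟩, hmk⟩
  have h := RG.of_eq_of_iso (k := k)
    (RibbonGraph.nonempty_iso_of_unique_edge L (RibbonGraph.strands 1))
  have h' := (congrArg Z.act h).symm.trans (Z.act_of_comp _ _)
  have hA := (Z.act_of_juxt RibbonGraph.arc (RibbonGraph.strands 1)).trans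
    (congrArg (EndProp.tensor _) (Z.act_strands 1))
  have hB := (Z.act_of_juxt (RibbonGraph.strands 1) RibbonGraph.coarc).trans
    (congrArg (fun f => EndProp.tensor f _) (Z.act_strands 1))
  let X : ⨂[k]^1 V := PiTensorProduct.tprod k (fun _ : Fin 1 => x)
  have hX : Z.act (RG.of k ((RibbonGraph.strands 1).juxt RibbonGraph.coarc)) X =
      TensorPower.mulEquiv (n := 1) (m := 2) (X ⊗ₜ[k] Z.copairing) := by
    refine (LinearMap.congr_fun hB X).trans ((EndProp.tensor_tprod (k := k) (p := 1) (p' := 0)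
      (q := 1) (q' := 2) LinearMap.id _ (fun _ => x)).trans ?_)
    rw [LinearMap.id_apply, copairing]
    congr 4
    funext i
    exact i.elim0
  calc EndProp.contractLeft Z.inner x Z.copairing
      = EndProp.single (EndProp.tensor (Z.act (RG.of k RibbonGraph.arc))
          (LinearMap.id (M := ⨂[k]^1 V))
          (TensorPower.mulEquiv (n := 1) (m := 2) (X ⊗ₜ[k] Z.copairing))) :=
        (Z.tensor_arc_id x _).symm
    _ = EndProp.single (Z.act (RG.of k (RibbonGraph.arc.juxt (RibbonGraph.strands 1)))
          (Z.act (RG.of k ((RibbonGraph.strands 1).juxt RibbonGraph.coarc)) X)) :=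
        congrArg EndProp.single ((LinearMap.congr_fun hA _).symm.trans
          (congrArg (Z.act (RG.of k (RibbonGraph.arc.juxt (RibbonGraph.strands 1)))) hX.symm))
    _ = EndProp.single X := congrArg EndProp.single
        ((LinearMap.congr_fun h' X).symm.trans (LinearMap.congr_fun (Z.act_strands 1) X))
    _ = x := EndProp.single_tprod _

/-- By the zigzag identity, `x` is recovered from `Z.inner x`, which gives injectivity. It also lies
in the finite-dimensional subspace spanned by the second factors of the copairing, so `V` is finite
dimensional. -/
theorem inner_isPerfPair : Z.inner.IsPerfPair := by
  have hinj : Function.Injective Z.inner := by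
    refine (injective_iff_map_eq_zero _).2 fun x hx => ?_
    rw [← Z.contractLeft_copairing x]
    simp [EndProp.contractLeft, hx]
  have hflip : Z.inner.flip = Z.inner := by
    ext x y
    exact Z.inner_symm y x
  have hfg : ∀ t : ⨂[k]^2 V, ∃ W : Submodule k V, W.FG ∧
      ∀ x, EndProp.contractLeft Z.inner x t ∈ W := by
    intro t
    have ht : t ∈ Submodule.span k (Set.range (PiTensorProduct.tprod k (s := fun _ : Fin 2 => V))) := by
      rw [PiTensorProduct.span_tprod_eq_top]
      trivial
    induction ht using Submodule.span_induction with
    | mem t ht =>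
      obtain ⟨c, rfl⟩ := ht
      refine ⟨Submodule.span k {c 1}, Submodule.fg_span_singleton _, fun x => ?_⟩
      rw [EndProp.contractLeft_tprod]
      exact Submodule.smul_mem _ _ (Submodule.mem_span_singleton_self _)
    | zero => exact ⟨⊥, Submodule.fg_bot, fun x => by simp⟩
    | add t t' _ _ h h' =>
      obtain ⟨W, hW, h⟩ := h
      obtain ⟨W', hW', h'⟩ := h'
      refine ⟨W ⊔ W', hW.sup hW', fun x => ?_⟩
      rw [map_add]
      exact Submodule.add_mem_sup (h x) (h' x)
    | smul a t _ h =>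
      obtain ⟨W, hW, h⟩ := h
      exact ⟨W, hW, fun x => by rw [map_smul]; exact W.smul_mem _ (h x)⟩
  have : FiniteDimensional k V := by
    obtain ⟨W, hW, h⟩ := hfg Z.copairing
    obtain rfl : W = ⊤ := by
      rw [eq_top_iff]
      intro x _
      rw [← Z.contractLeft_copairing x]
      exact h x
    exact ⟨hW⟩
  exact LinearMap.IsPerfPair.of_injective hinj (by rwa [hflip])

/-- The cyclic algebra attached to an algebra over the PROP of ribbon graphs. -/
noncomputable def toCyclicAlgebra : CyclicAlgebra k V where
  b := Z.inner
  symm := Z.inner_symm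
  nondegenerate := Z.inner_isPerfPair
  T r := (EndProp.scalar k V).toLinearMap ∘ₗ Z.act (RG.of k (RibbonGraph.corolla r))
  cyclic r x := by
    rcases r with _ | n
    · congr 2
    · exact Z.act_corolla_tprod_cyclic n x

/-- The value of the outgoing arc is determined by the inner product. -/
theorem copairing_eq {I : Type} [Fintype I] [DecidableEq I] (D : DualFrame Z.inner I) :
    Z.copairing = ∑ d : Fin 2 → I, Z.inner (D.vec false (d 0)) (D.vec false (d 1)) •
      PiTensorProduct.tprod k (fun i => D.vec true (d i)) := by
  -- The coefficients of a tensor in the basis `D.vec true` are its pairings with `D.vec false`.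
  have hexp : ∀ t : ⨂[k]^2 V, t = ∑ d : Fin 2 → I,
      tensorPairing Z.inner (fun i => D.vec false (d i)) t •
        PiTensorProduct.tprod k (fun i => D.vec true (d i)) := by
    intro t
    suffices h : LinearMap.id = ∑ d : Fin 2 → I,
        (tensorPairing Z.inner (fun i => D.vec false (d i))).smulRight
          (PiTensorProduct.tprod k (fun i => D.vec true (d i))) by
      simpa using LinearMap.congr_fun h t
    ext c
    simpa using (D.sum_smul_tprod true c).symm
  -- Pairing in two slots is contraction of the first followed by pairing with the second; on the
  -- copairing, the zigzag identity evaluates the contraction.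
  have hpair : ∀ (x y : V) (t : ⨂[k]^2 V), tensorPairing Z.inner ![x, y] t =
      Z.inner (EndProp.contractLeft Z.inner x t) y := by
    intro x y t
    suffices h : tensorPairing Z.inner ![x, y] =
        Z.inner.flip y ∘ₗ EndProp.contractLeft Z.inner x from LinearMap.congr_fun h t
    ext c
    simp [EndProp.contractLeft_tprod, Fin.prod_univ_two, Z.inner_symm x]
  conv_lhs => rw [hexp Z.copairing]
  refine Finset.sum_congr rfl fun d _ => ?_
  have hd : (fun i => D.vec false (d i)) = ![D.vec false (d 0), D.vec false (d 1)] := by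
    funext i
    fin_cases i <;> rfl
  rw [hd, hpair, contractLeft_copairing]

/-! ### Bijectivity of the correspondence -/

theorem act_coarc_eq {Z Z' : RGAlgebra k V} (h : Z.inner = Z'.inner) :
    Z.act (RG.of k RibbonGraph.coarc) = Z'.act (RG.of k RibbonGraph.coarc) := by
  obtain ⟨n, ⟨D⟩⟩ := Z.toCyclicAlgebra.exists_dualFrame
  have hcop : Z.copairing = Z'.copairing := by
    rw [Z.copairing_eq D]
    -- A frame for one inner product serves for the other, as they are equal; `copairing_eq` then
    -- gives the same expression for both.
    change DualFrame Z.inner (Fin n) at D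
    revert D
    rw [h]
    exact fun D => (Z'.copairing_eq D).symm
  ext x
  rw [LinearMap.compMultilinearMap_apply, LinearMap.compMultilinearMap_apply,
    Subsingleton.elim x Fin.elim0]
  exact hcop

/-- Two structures with equal `b` and `T` agree on the generators, hence on all graphs by induction
on `Generated`, hence on their linear combinations. -/
theorem toCyclicAlgebra_injective :
    Function.Injective (toCyclicAlgebra : RGAlgebra k V → CyclicAlgebra k V) := by
  intro Z Z' h
  have hb : Z.inner = Z'.inner := congrArg CyclicAlgebra.b h
  have hT : ∀ r, Z.act (RG.of k (RibbonGraph.corolla r)) =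
      Z'.act (RG.of k (RibbonGraph.corolla r)) := fun r => by
    have := congrFun (congrArg CyclicAlgebra.T h) r
    ext x
    exact (EndProp.scalar k V).injective (LinearMap.congr_fun this (PiTensorProduct.tprod k x))
  have key : ∀ {p q : ℕ} (G : RibbonGraph p q), Z.act (RG.of k G) = Z'.act (RG.of k G) := by
    intro p q G
    induction G.generated with
    | iso e _ ih => rw [← RG.of_eq_of_iso e, ih]
    | strands n => rw [Z.act_strands, Z'.act_strands]
    | crossing m n => rw [Z.act_crossing, Z'.act_crossing]
    | arc =>
      ext x
      rw [LinearMap.compMultilinearMap_apply, LinearMap.compMultilinearMap_apply,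
        act_arc_tprod, act_arc_tprod, hb]
    | coarc => exact act_coarc_eq hb
    | corolla r => exact hT r
    | comp _ _ ih ih' => rw [act_of_comp, act_of_comp, ih, ih']
    | juxt _ _ ih ih' => rw [act_of_juxt, act_of_juxt, ih, ih']
  refine RGAlgebra.ext ?_
  funext p q
  refine Finsupp.lhom_ext' fun G => LinearMap.ext_ring ?_
  induction G using Quotient.ind with
  | _ G => exact key G

/-- The state sum for any dual frame is a preimage, because it returns `b` on the arc and `T r` on
the corollas. -/
theorem toCyclicAlgebra_surjective :
    Function.Surjective (toCyclicAlgebra : RGAlgebra k V → CyclicAlgebra k V) := by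
  intro C
  obtain ⟨n, ⟨D⟩⟩ := C.exists_dualFrame
  refine ⟨ofDualFrame D, ?_⟩
  refine CyclicAlgebra.ext ?_ ?_
  · ext x y
    change EndProp.scalar k V ((ofDualFrame D).act (RG.of k RibbonGraph.arc) _) = _
    rw [ofDualFrame_act_of, RibbonGraph.stateSum_arc]
  · funext r
    refine LinearMap.ext fun t => ?_
    change EndProp.scalar k V ((ofDualFrame D).act (RG.of k (RibbonGraph.corolla r)) t) = _
    rw [ofDualFrame_act_of, RibbonGraph.stateSum_corolla]

end RGAlgebra

end

theorem theorem2 (k : Type u) [Field k] (V : Type v) [AddCommGroup V] [Module k V] :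
    ∃ e : RGAlgebra k V ≃ CyclicAlgebra k V, ∀ Z : RGAlgebra k V,
      (∀ x y : V, (e Z).b x y = EndProp.scalar k V
        (Z.act (RG.of k RibbonGraph.arc) (PiTensorProduct.tprod k ![x, y]))) ∧
      (∀ (r : ℕ) (t : ⨂[k]^r V), (e Z).T r t = EndProp.scalar k V
        (Z.act (RG.of k (RibbonGraph.corolla r)) t)) :=
  ⟨Equiv.ofBijective RGAlgebra.toCyclicAlgebra
    ⟨RGAlgebra.toCyclicAlgebra_injective, RGAlgebra.toCyclicAlgebra_surjective⟩,
    fun _ => ⟨fun _ _ => rfl, fun _ _ => rfl⟩⟩
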